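/- Let $E:[0,\infty)\times\mathbb R^2\to\mathbb R^2$ be bounded and Lipschitz in $(t,x)$ (that is, the continuous representative of a field in $W^{1,\infty}$), and put $K_x:=\|D_xE\|_{L^\infty}$ (Euclidean norms on vectors, operator norm on matrices). Write $v^\perp=(-v_2,v_1)$. There is a constant $C>0$ depending only on $E$ such that the following holds for every Borel probability measure $f_0$ on $\mathbb R^2\times\mathbb R^2$ with finite first moment, and all $\varepsilon>0$, $\Delta t>0$, $n\in\mathbb N$, $t_n:=n\Delta t$. Let $f^\varepsilon=(f^\varepsilon(t))_{t\ge0}$ be a weak solution, weakly continuous in time with values in the probability measures on $\mathbb R^2\times\mathbb R^2$, of the Vlasov equation $$\varepsilon\,\partial_t f^\varepsilon+\mathrm{div}_x(v f^\varepsilon)+\mathrm{div}_v\Big(\big(E(t,x)-\tfrac1\varepsilon v^\perp\big)f^\varepsilon\Big)=0,\qquad f^\varepsilon(0)=f_0,$$ and let $\rho^\varepsilon(t,\cdot)=\int_{\mathbb R^2} f^\varepsilon(t,\cdot,\mathrm dv)$ be its charge density, i.e. the $x$-marginal of $f^\varepsilon(t)$. Let $X^{\Delta t}_\varepsilon(t_n,0,x,v):=x^n$,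 where $(x^n,v^n)_{n\ge0}$ is the unique solution of the semi-implicit scheme $$\frac{x^{n+1}-x^n}{\Delta t}=\frac{v^{n+1}}{\varepsilon},\qquad \varepsilon\,\frac{v^{n+1}-v^n}{\Delta t}=E(t_n,x^n)-\frac{(v^{n+1})^\perp}{\varepsilon},\qquad (x^0,v^0)=(x,v),$$ and let $\rho^\varepsilon_{\Delta t}(t_n,\cdot)$ be the push-forward of $f_0$ by $(x,v)\mapsto X^{\Delta t}_\varepsilon(t_n,0,x,v)$. Then $$\|\rho^\varepsilon_{\Delta t}(t_n,\cdot)-\rho^\varepsilon(t_n,\cdot)\|_{\dot W^{-1,1}}\le C\,\min\Big(\frac{\Delta t}{\varepsilon^3}(1+\varepsilon^2),\ \Delta t+\varepsilon\Big)\,e^{2K_xt_n}\,(1+t_n^2)\int_{\mathbb R^2\times\mathbb R^2}(1+\varepsilon+\|v\|)\,\mathrm df_0(x,v),$$ where $\|\mu\|_{\dot W^{-1,1}}:=\sup\big\{\big|\int\varphi\,\mathrm d\mu\big| : \varphi\in W^{1,\infty}(\mathbb R^2),\ \|\nabla\varphi\|_{L^\infty}\le1\big\}$ is the canonical seminorm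 on $W^{-1,1}=(W^{1,\infty})^*$. -/

import Mathlib

open MeasureTheory
open scoped ContDiff ENNReal NNReal

noncomputable section

namespace GyroVlasov

/-- The plane `ℝ²` with its Euclidean norm. -/
abbrev Plane : Type := EuclideanSpace ℝ (Fin 2)

/-- The phase space of pairs `(x, v)`. -/
abbrev Phase : Type := Plane × Plane

/-- The rotated vector `v^⊥ = J v = (-v₂, v₁)`. -/
def perp (v : Plane) : Plane := !₂[-(v 1), v 0]

/-- `E ∈ W^{1,∞}` for a field `E(t, x)` on `[0, ∞) × ℝ²`, represented by its continuous
representative: `E` is bounded and Lipschitz in `(t, x)`. Values at negative times are irrelevant. -/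
def IsLipschitzField (E : ℝ → Plane → Plane) : Prop :=
  (∃ M : ℝ, ∀ t : ℝ, 0 ≤ t → ∀ x : Plane, ‖E t x‖ ≤ M) ∧
  ∃ L : ℝ≥0, LipschitzOnWith L (fun q : ℝ × Plane => E q.1 q.2) (Set.Ici 0 ×ˢ Set.univ)

/-- `K_x = ‖D_x E‖_{L^∞([0, ∞) × ℝ²)}`, with the operator norm on `D_x E(t, x)`. For a Lipschitz
field the derivative exists almost everywhere, and the essential supremum is finite. -/
def lipX (E : ℝ → Plane → Plane) : ℝ :=
  (essSup (fun q : ℝ × Plane => ‖fderiv ℝ (E q.1) q.2‖ₑ)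
    (volume.restrict (Set.Ici (0 : ℝ) ×ˢ (Set.univ : Set Plane)))).toReal

/-- The test functions of the `W^{-1,1}` seminorm on the plane: real functions `φ ∈ W^{1,∞}(ℝ²)`,
that is, bounded Lipschitz functions, with `‖∇φ‖_{L^∞} ≤ 1`. -/
def IsTestFunction (φ : Plane → ℝ) : Prop :=
  (∃ M : ℝ, ∀ x, |φ x| ≤ M) ∧ (∃ L : ℝ≥0, LipschitzWith L φ) ∧
  essSup (fun x => ‖fderiv ℝ φ x‖ₑ) volume ≤ 1

/-- The seminorm `‖μ - ν‖_{W^{-1,1}}`, the supremum of `|∫ φ d(μ - ν)|` over the functions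
`φ ∈ W^{1,∞}(ℝ²)` with `‖∇φ‖_{L^∞} ≤ 1`, for finite measures `μ` and `ν`. -/
def wNegDist (μ ν : Measure Plane) : ℝ≥0∞ :=
  ⨆ φ : {φ : Plane → ℝ // IsTestFunction φ},
    ENNReal.ofReal |(∫ x, φ.1 x ∂μ) - ∫ x, φ.1 x ∂ν|

/-- The curve `t ↦ f t` (`t ≥ 0`) of probability measures on phase space, continuous for the weak
convergence of measures, is a weak solution with initial datum `f₀` of the Vlasov equation
`ε ∂_t f + div_x (v f) + div_v ((E - v^⊥ / ε) f) = 0`.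
In the weak formulation,
`fderiv ℝ φ (x, v) (v, E - v^⊥ / ε) = v · ∇_x φ + (E - v^⊥ / ε) · ∇_v φ`. -/
def IsVlasovSolution (ε : ℝ) (E : ℝ → Plane → Plane) (f₀ : ProbabilityMeasure Phase)
    (f : ℝ → ProbabilityMeasure Phase) : Prop :=
  f 0 = f₀ ∧ ContinuousOn f (Set.Ici 0) ∧
  ∀ φ : Phase → ℝ, ContDiff ℝ ∞ φ → HasCompactSupport φ → ∀ t : ℝ, 0 ≤ t →
    ε * ((∫ p, φ p ∂(f t : Measure Phase)) - ∫ p, φ p ∂(f₀ : Measure Phase)) =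
      ∫ s in (0 : ℝ)..t,
        ∫ p, fderiv ℝ φ p (p.2, E s p.1 - ε⁻¹ • perp p.2) ∂(f s : Measure Phase)

/-- The charge density of a phase-space measure, `ρ = ∫ f dv`: its marginal in `x`. -/
def chargeDensity (f : Measure Phase) : Measure Plane := f.map Prod.fst

/-- One step from `p = (xⁿ, vⁿ)` at time `t = t_n` to `q = (xⁿ⁺¹, vⁿ⁺¹)` of the semi-implicit
first-order scheme. -/
def IsSchemeStep (ε Δt : ℝ) (E : ℝ → Plane → Plane) (t : ℝ) (p q : Phase) : Prop :=
  Δt⁻¹ • (q.1 - p.1) = ε⁻¹ • q.2 ∧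
  ε • Δt⁻¹ • (q.2 - p.2) = E t p.1 - ε⁻¹ • perp q.2

/-- The velocity update of the scheme: the solution `w` of
`w + λ w^⊥ = vⁿ + (Δt / ε) E(t_n, xⁿ)`, with `λ = Δt / ε²`. -/
def velocityUpdate (ε Δt : ℝ) (E : ℝ → Plane → Plane) (t : ℝ) (p : Phase) : Plane :=
  (1 + (Δt / ε ^ 2) ^ 2)⁻¹ •
    ((p.2 + (Δt / ε) • E t p.1) - (Δt / ε ^ 2) • perp (p.2 + (Δt / ε) • E t p.1))

/-- One step of the scheme, solved for the new position and velocity. -/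
def schemeStep (ε Δt : ℝ) (E : ℝ → Plane → Plane) (t : ℝ) (p : Phase) : Phase :=
  (p.1 + (Δt / ε) • velocityUpdate ε Δt E t p, velocityUpdate ε Δt E t p)

/-- The implicit equations of the scheme have exactly one solution, namely `schemeStep`. -/
theorem isSchemeStep_iff {ε Δt : ℝ} (hε : 0 < ε) (hΔt : 0 < Δt) (E : ℝ → Plane → Plane) (t : ℝ)
    (p q : Phase) : IsSchemeStep ε Δt E t p q ↔ q = schemeStep ε Δt E t p := by
  have hl : (1 + (Δt / ε ^ 2) ^ 2) ≠ 0 := by positivity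
  have he := hε.ne'
  have hd := hΔt.ne'
  obtain ⟨x, v⟩ := p
  obtain ⟨y, w⟩ := q
  simp only [IsSchemeStep, schemeStep, velocityUpdate, Prod.mk.injEq]
  constructor
  · rintro ⟨h1, h2⟩
    have h2' : w = (1 + (Δt / ε ^ 2) ^ 2)⁻¹ •
        ((v + (Δt / ε) • E t x) - (Δt / ε ^ 2) • perp (v + (Δt / ε) • E t x)) := by
      have a0 := congrArg (fun u : Plane => u 0) h2
      have a1 := congrArg (fun u : Plane => u 1) h2
      simp [perp] at a0 a1
      field_simp at a0 a1
      ext i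
      fin_cases i
      · simp [perp]
        field_simp
        linear_combination (ε ^ 2) * a0 + Δt * a1
      · simp [perp]
        field_simp
        linear_combination (ε ^ 2) * a1 - Δt * a0
    refine ⟨?_, h2'⟩
    rw [← h2']
    ext i
    have a := congrArg (fun u : Plane => u i) h1
    simp at a
    field_simp at a
    simp
    field_simp
    linear_combination a
  · rintro ⟨h1, h2⟩
    rw [← h2] at h1
    constructor
    · rw [h1]
      ext i
      simp
      field_simp
    · rw [h2]
      ext i
      fin_cases i
      · simp [perp]
        field_simp
        ring
      · simp [perp]
        field_simp
        ring

/-- The discrete flow `(X_ε^Δt, V_ε^Δt)(t_n, 0, x, v)` of the scheme, with `t_n = n Δt`. -/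
def discreteFlow (ε Δt : ℝ) (E : ℝ → Plane → Plane) : ℕ → Phase → Phase
  | 0, p => p
  | n + 1, p => schemeStep ε Δt E (n * Δt) (discreteFlow ε Δt E n p)

/-- The discrete charge density at time `t_n`, the push-forward of `f₀` by the position component
`X_ε^Δt(t_n, 0, ·, ·)` of the discrete flow. -/
def discreteDensity (ε Δt : ℝ) (E : ℝ → Plane → Plane) (f₀ : Measure Phase) (n : ℕ) :
    Measure Plane :=
  f₀.map (fun p => (discreteFlow ε Δt E n p).1)

end GyroVlasov

end

set_option linter.unusedSectionVars false

/-! The exact characteristics are never constructed. The scheme with step `Δt` is compared with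
itself at step `Δt / m`, along each trajectory and with a bound independent of `m`. Letting `m` tend
to infinity, the refined scheme converges, against bounded Lipschitz functions, to any weak
solution. The pathwise bound, integrated against `f₀`, therefore passes to the solution.

Pathwise bound (`exists_refinement_bound`). The implicit rotation solve is nonexpansive for every
stiffness, and the guiding center `x - ε v^⊥` advances by exactly `-h E^⊥(tₙ, xₙ)`, without negative
powers of `ε`. The corrected velocity `v + ε E^⊥` grows at rate `K` whatever `ε` is, so all
velocities stay below `e^{Kt} W`, where `W` is controlled by `ε + ‖v₀‖` and is affine in the final
time. Two estimates follow. Consistency of one large step with `m` small ones, for guiding center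
and velocity together, gives the error in `Δt / ε³`. Comparing only the guiding centers, and
bounding `ε ‖V - v‖` by the size of the velocities, gives the error in `Δt + ε`. Discrete Gronwall
yields both.

Limit `m → ∞` (`exists_step_size_of_bounded`). This is a duality argument: the test function is
pulled back through the steps of the scheme and tested on `f`. The pullbacks are only Lipschitz, so
each is mollified by one fixed bump of radius `δ`. A step of length `h` costs `O(δ h)` for commuting
mollification with transport, plus `O(h²)` with a constant depending on `δ`. Summing over the steps,
then choosing `δ` before `h`, gives convergence. A cutoff argument extends it from compactly
supported to bounded test functions. -/

namespace GyroVlasov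

/-! ### From almost-everywhere derivative bounds to Lipschitz constants. -/

section LipschitzConstant

variable {V : Type*} [NormedAddCommGroup V] [NormedSpace ℝ V] [FiniteDimensional ℝ V]
  [MeasurableSpace V] [BorelSpace V] {μ : Measure V} [μ.IsAddHaarMeasure]

/-- A real Lipschitz function whose derivative is almost everywhere at most `K` in norm is
`K`-Lipschitz. -/
theorem abs_sub_le_of_ae_norm_fderiv_le {f : V → ℝ} {C : ℝ≥0} (hf : LipschitzWith C f) {K : ℝ}
    (hK : ∀ᵐ x ∂μ, ‖fderiv ℝ f x‖ ≤ K) (x h : V) : |f (x + h) - f x| ≤ K * ‖h‖ := by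
  have hgood : ∀ᵐ x ∂μ, DifferentiableAt ℝ f x ∧ ‖fderiv ℝ f x‖ ≤ K :=
    hf.ae_differentiableAt.and hK
  -- A measurable null set containing all bad points makes Fubini available: every translate of `G`
  -- is null, so almost every line in direction `h` meets `G` in a null set of parameters. On such a
  -- line the fundamental theorem of calculus applies to the Lipschitz restriction.
  obtain ⟨G, hGsub, hGmeas, hGnull⟩ := exists_measurable_superset_of_null hgood
  have hG : ∀ y, y ∉ G → DifferentiableAt ℝ f y ∧ ‖fderiv ℝ f y‖ ≤ K := by
    intro y hy
    by_contra hcon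
    exact hy (hGsub hcon)
  have hline : ∀ᵐ z ∂μ, ∀ᵐ s : ℝ, z + s • h ∉ G := by
    have hmeas : MeasurableSet {q : V × ℝ | q.1 + q.2 • h ∉ G} :=
      (hGmeas.preimage (by fun_prop : Measurable fun q : V × ℝ => q.1 + q.2 • h)).compl
    rw [Measure.ae_ae_comm hmeas]
    filter_upwards with s
    have := measure_preimage_add_right μ (s • h) G
    rw [hGnull] at this
    exact measure_eq_zero_iff_ae_notMem.mp this
  have hae : ∀ᵐ z ∂μ, |f (z + h) - f z| ≤ K * ‖h‖ := by
    filter_upwards [hline] with z hz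
    have hlip : LipschitzWith (C * ‖h‖₊) (fun s : ℝ => f (z + s • h)) := by
      refine hf.comp (LipschitzWith.of_dist_le_mul fun s t => ?_)
      rw [dist_add_left, dist_eq_norm, ← sub_smul, norm_smul, mul_comm, dist_eq_norm]
      rfl
    have hac : AbsolutelyContinuousOnInterval (fun s : ℝ => f (z + s • h)) 0 1 :=
      (hlip.lipschitzOnWith).absolutelyContinuousOnInterval
    have hint := hac.integral_deriv_eq_sub
    simp only [one_smul, zero_smul, add_zero] at hint
    rw [← hint, ← Real.norm_eq_abs]
    have := intervalIntegral.norm_integral_le_of_norm_le_const_ae (a := 0) (b := 1)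
      (f := deriv (fun s : ℝ => f (z + s • h))) (C := K * ‖h‖) ?_
    · simpa using this
    · filter_upwards [hz] with s hs _
      obtain ⟨hd, hb⟩ := hG _ hs
      have hline' : HasDerivAt (fun s : ℝ => z + s • h) h s := by
        simpa using ((hasDerivAt_id s).smul_const h).const_add z
      have hder : HasDerivAt (fun s : ℝ => f (z + s • h)) (fderiv ℝ f (z + s • h) h) s :=
        hd.hasFDerivAt.comp_hasDerivAt s hline'
      rw [hder.deriv]
      exact (ContinuousLinearMap.le_opNorm _ _).trans (by gcongr)
  have hdense := Measure.dense_of_ae hae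
  have hcl : IsClosed {z : V | |f (z + h) - f z| ≤ K * ‖h‖} := by
    have := hf.continuous
    exact isClosed_le (by fun_prop) continuous_const
  have := hdense.closure_eq
  rw [hcl.closure_eq] at this
  exact this.ge (Set.mem_univ x)

/-- A Lipschitz map whose derivative is almost everywhere at most `K` in norm is `K`-Lipschitz. -/
theorem norm_sub_le_of_ae_norm_fderiv_le {F : Type*} [NormedAddCommGroup F] [NormedSpace ℝ F]
    [FiniteDimensional ℝ F] {f : V → F} {C : ℝ≥0} (hf : LipschitzWith C f) {K : ℝ}
    (hK : ∀ᵐ x ∂μ, ‖fderiv ℝ f x‖ ≤ K) (x y : V) : ‖f x - f y‖ ≤ K * ‖x - y‖ := by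
  obtain ⟨g, hg, hgv⟩ := exists_dual_vector'' ℝ (f x - f y)
  have hlip : LipschitzWith (‖g‖₊ * C) (fun z => g (f z)) := g.lipschitz.comp hf
  have hK' : ∀ᵐ z ∂μ, ‖fderiv ℝ (fun z => g (f z)) z‖ ≤ K := by
    filter_upwards [hK, hf.ae_differentiableAt] with z hz hd
    have : fderiv ℝ (fun z => g (f z)) z = g.comp (fderiv ℝ f z) :=
      (g.hasFDerivAt.comp z hd.hasFDerivAt).fderiv
    rw [this]
    calc _ ≤ ‖g‖ * ‖fderiv ℝ f z‖ := g.opNorm_comp_le _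
      _ ≤ 1 * K := by gcongr
      _ = K := one_mul K
  have := abs_sub_le_of_ae_norm_fderiv_le hlip hK' y (x - y)
  rw [add_sub_cancel, ← map_sub, hgv] at this
  simpa using this

end LipschitzConstant

/-- A test function of the `W^{-1,1}` seminorm is `1`-Lipschitz. -/
theorem IsTestFunction.abs_sub_le {φ : Plane → ℝ} (hφ : IsTestFunction φ) (x y : Plane) :
    |φ x - φ y| ≤ ‖x - y‖ := by
  obtain ⟨-, ⟨L, hL⟩, hsup⟩ := hφ
  have hae : ∀ᵐ z : Plane, ‖fderiv ℝ φ z‖ ≤ 1 := by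
    filter_upwards [ENNReal.ae_le_essSup (μ := volume) fun z : Plane => ‖fderiv ℝ φ z‖ₑ] with z hz
    have := hz.trans hsup
    rw [← ofReal_norm, ENNReal.ofReal_le_one] at this
    exact this
  simpa using norm_sub_le_of_ae_norm_fderiv_le hL hae x y

/-- The field is `lipX E`-Lipschitz in space, uniformly in `t ≥ 0`. -/
theorem IsLipschitzField.norm_sub_le_lipX {E : ℝ → Plane → Plane} (hE : IsLipschitzField E)
    {t : ℝ} (ht : 0 ≤ t) (x y : Plane) : ‖E t x - E t y‖ ≤ lipX E * ‖x - y‖ := by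
  obtain ⟨-, L, hL⟩ := hE
  have hslice : ∀ s, 0 ≤ s → LipschitzWith L (E s) := by
    intro s hs
    refine LipschitzWith.of_dist_le_mul fun a b => ?_
    have := hL.dist_le_mul (s, a) ⟨hs, trivial⟩ (s, b) ⟨hs, trivial⟩
    simpa [Prod.dist_eq] using this
  set S : ℝ≥0∞ := essSup (fun q : ℝ × Plane => ‖fderiv ℝ (E q.1) q.2‖ₑ)
    (volume.restrict (Set.Ici (0 : ℝ) ×ˢ (Set.univ : Set Plane))) with hS
  have hfin : S ≤ L := by
    refine essSup_le_of_ae_le _ ?_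
    filter_upwards [ae_restrict_mem (measurableSet_Ici.prod MeasurableSet.univ)] with q hq
    rw [← ofReal_norm, ← ENNReal.ofReal_coe_nnreal]
    exact ENNReal.ofReal_le_ofReal (norm_fderiv_le_of_lipschitz ℝ (hslice _ hq.1))
  have hae : ∀ᵐ q : ℝ × Plane ∂((volume.restrict (Set.Ici (0 : ℝ))).prod volume),
      ‖fderiv ℝ (E q.1) q.2‖ ≤ lipX E := by
    have h1 := ENNReal.ae_le_essSup
      (μ := volume.restrict (Set.Ici (0 : ℝ) ×ˢ (Set.univ : Set Plane)))
      fun q : ℝ × Plane => ‖fderiv ℝ (E q.1) q.2‖ₑ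
    have h2 : ((volume : Measure ℝ).restrict (Set.Ici (0 : ℝ))).prod (volume : Measure Plane) =
        (volume : Measure (ℝ × Plane)).restrict (Set.Ici (0 : ℝ) ×ˢ (Set.univ : Set Plane)) := by
      conv_lhs => rw [← Measure.restrict_univ (μ := (volume : Measure Plane))]
      rw [Measure.prod_restrict]
      rfl
    rw [h2]
    filter_upwards [h1] with q hq
    rw [← toReal_enorm]
    exact ENNReal.toReal_mono (ne_top_of_le_ne_top ENNReal.coe_ne_top hfin) hq
  have hae' : ∀ᵐ s : ℝ ∂(volume.restrict (Set.Ici (0 : ℝ))),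
      ‖E s x - E s y‖ ≤ lipX E * ‖x - y‖ := by
    filter_upwards [Measure.ae_ae_of_ae_prod hae, ae_restrict_mem measurableSet_Ici] with s hs hs0
    exact norm_sub_le_of_ae_norm_fderiv_le (hslice s hs0) hs x y
  have htime : ∀ z, ContinuousOn (fun s => E s z) (Set.Ici 0) := fun z =>
    hL.continuousOn.comp (f := fun s : ℝ => (s, z)) (by fun_prop) fun s hs => ⟨hs, trivial⟩
  rw [ae_restrict_iff' measurableSet_Ici] at hae'
  -- Fubini gives the sharp constant for almost every time only. Good positive times are dense in
  -- `[0, ∞)`, including near `0`, and `E` is continuous in time, so the bound extends to every `t ≥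
  -- 0`.
  have hcl : t ∈ closure {s : ℝ | 0 < s ∧ (s ∈ Set.Ici (0 : ℝ) →
      ‖E s x - E s y‖ ≤ lipX E * ‖x - y‖)} := by
    have hsub := closure_minimal ((Measure.dense_of_ae hae').open_subset_closure_inter
      (isOpen_Ioi (a := (0 : ℝ)))) isClosed_closure
    rw [closure_Ioi] at hsub
    exact hsub ht
  obtain ⟨u, hu, hut⟩ := mem_closure_iff_seq_limit.mp hcl
  have hut' : Filter.Tendsto u Filter.atTop (nhdsWithin t (Set.Ici 0)) :=
    tendsto_nhdsWithin_iff.mpr ⟨hut, Filter.Eventually.of_forall fun n => (hu n).1.le⟩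
  exact le_of_tendsto' ((((htime x) t ht).tendsto.comp hut').sub
    (((htime y) t ht).tendsto.comp hut')).norm fun n => (hu n).2 (hu n).1.le

/-! ### Algebra of the rotation. -/

theorem perp_add (v w : Plane) : perp (v + w) = perp v + perp w := by
  ext i; fin_cases i <;> simp [perp]; ring

theorem perp_smul (c : ℝ) (v : Plane) : perp (c • v) = c • perp v := by
  ext i; fin_cases i <;> simp [perp]

theorem perp_sub (v w : Plane) : perp (v - w) = perp v - perp w := by
  ext i; fin_cases i <;> simp [perp]; ring

theorem perp_perp (v : Plane) : perp (perp v) = -v := by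
  ext i; fin_cases i <;> simp [perp]

theorem norm_perp (v : Plane) : ‖perp v‖ = ‖v‖ := by
  simp [EuclideanSpace.norm_eq, perp, add_comm]

theorem norm_add_smul_perp_sq (c : ℝ) (v : Plane) :
    ‖v + c • perp v‖ ^ 2 = (1 + c ^ 2) * ‖v‖ ^ 2 := by
  simp [EuclideanSpace.norm_sq_eq, perp]
  ring

/-- Since `v` and `v^⊥` are orthogonal, inverting `v ↦ v + c v^⊥` never increases norms, for any
`c`. All stability uniform in `h / ε²` comes from here. -/
theorem norm_le_norm_add_smul_perp (c : ℝ) (v : Plane) : ‖v‖ ≤ ‖v + c • perp v‖ := by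
  refine le_of_sq_le_sq ?_ (norm_nonneg _)
  rw [norm_add_smul_perp_sq]
  nlinarith [sq_nonneg (c * ‖v‖)]

/-! ### Field bounds, orbits of the scheme and discrete Gronwall. -/

/-- Explicit bounds for a Lipschitz field on `t ≥ 0`: `K` in space, `L` in time, `M` in size. -/
structure FieldBounds (E : ℝ → Plane → Plane) (K L M : ℝ) : Prop where
  K_nonneg : 0 ≤ K
  L_nonneg : 0 ≤ L
  M_nonneg : 0 ≤ M
  space : ∀ t, 0 ≤ t → ∀ x y, ‖E t x - E t y‖ ≤ K * ‖x - y‖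
  time : ∀ s t, 0 ≤ s → 0 ≤ t → ∀ x, ‖E s x - E t x‖ ≤ L * |s - t|
  size : ∀ t, 0 ≤ t → ∀ x, ‖E t x‖ ≤ M

theorem FieldBounds.norm_sub_le {E : ℝ → Plane → Plane} {K L M : ℝ} (hb : FieldBounds E K L M)
    {s t : ℝ} (hs : 0 ≤ s) (ht : 0 ≤ t) (x y : Plane) :
    ‖E s x - E t y‖ ≤ L * |s - t| + K * ‖x - y‖ :=
  (norm_sub_le_norm_sub_add_norm_sub _ (E t x) _).trans
    (add_le_add (hb.time s t hs ht x) (hb.space t ht x y))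

theorem IsLipschitzField.exists_fieldBounds {E : ℝ → Plane → Plane} (hE : IsLipschitzField E) :
    ∃ L M, FieldBounds E (lipX E) L M := by
  obtain ⟨M, hM⟩ := hE.1
  obtain ⟨L, hL⟩ := hE.2
  refine ⟨L, M, ENNReal.toReal_nonneg, L.2, (norm_nonneg _).trans (hM 0 le_rfl 0),
    fun t ht => hE.norm_sub_le_lipX ht, fun s t hs ht x => ?_, hM⟩
  have := hL.dist_le_mul (s, x) ⟨hs, trivial⟩ (t, x) ⟨ht, trivial⟩
  simpa [Prod.dist_eq, dist_eq_norm] using this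

/-- The sequence `(x n, v n)` is an orbit of the semi-implicit scheme with step `h`. -/
structure IsOrbit (ε h : ℝ) (E : ℝ → Plane → Plane) (x v : ℕ → Plane) : Prop where
  pos : ∀ n, x (n + 1) = x n + (h / ε) • v (n + 1)
  vel : ∀ n : ℕ, v (n + 1) + (h / ε ^ 2) • perp (v (n + 1)) = v n + (h / ε) • E (n * h) (x n)

theorem velocityUpdate_add_smul_perp (ε h : ℝ) (E : ℝ → Plane → Plane) (t : ℝ) (p : Phase) :
    velocityUpdate ε h E t p + (h / ε ^ 2) • perp (velocityUpdate ε h E t p) =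
      p.2 + (h / ε) • E t p.1 := by
  have hl : (1 + (h / ε ^ 2) ^ 2) ≠ 0 := by positivity
  simp only [velocityUpdate]
  generalize p.2 + (h / ε) • E t p.1 = u
  generalize h / ε ^ 2 = c at *
  rw [perp_smul, perp_sub, perp_smul, perp_perp, smul_comm c, ← smul_add]
  rw [show u - c • perp u + c • (perp u - c • -u) = (1 + c ^ 2) • u by module, smul_smul,
    inv_mul_cancel₀ hl, one_smul]

theorem isOrbit_discreteFlow (ε h : ℝ) (E : ℝ → Plane → Plane) (p : Phase) :
    IsOrbit ε h E (fun n => (discreteFlow ε h E n p).1) (fun n => (discreteFlow ε h E n p).2) :=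
  ⟨fun _ => rfl, fun _ => velocityUpdate_add_smul_perp _ _ _ _ _⟩

/-- Telescoping against a predicted increment `d`; this is how `m` small steps are compared with one
large step. -/
theorem norm_sub_sub_nsmul_le {F : Type*} [NormedAddCommGroup F] [NormedSpace ℝ F] {u : ℕ → F}
    {a m : ℕ} {d : F} {c : ℝ} (h : ∀ i < m, ‖u (a + i + 1) - u (a + i) - d‖ ≤ c) :
    ‖u (a + m) - u a - (m : ℝ) • d‖ ≤ m * c := by
  induction m with
  | zero => simp
  | succ m ih =>
    have h1 := ih fun i hi => h i (by omega)
    have h2 := h m (by omega)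
    calc ‖u (a + (m + 1)) - u a - ((m + 1 : ℕ) : ℝ) • d‖
        = ‖(u (a + m) - u a - (m : ℝ) • d) + (u (a + m + 1) - u (a + m) - d)‖ := by
          congr 1; push_cast; rw [← add_assoc]; module
      _ ≤ m * c + c := (norm_add_le _ _).trans (add_le_add h1 h2)
      _ = _ := by push_cast; ring

theorem norm_sub_le_nsmul {F : Type*} [NormedAddCommGroup F] [NormedSpace ℝ F] {u : ℕ → F}
    {a m : ℕ} {c : ℝ} (h : ∀ i < m, ‖u (a + i + 1) - u (a + i)‖ ≤ c) :
    ‖u (a + m) - u a‖ ≤ m * c := by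
  simpa using norm_sub_sub_nsmul_le (u := u) (a := a) (m := m) (d := 0) (c := c)
    (by simpa using h)

/-- The forcing may grow like `e^{c(n+1)}`, as the velocity bounds do. It is no larger than the
homogeneous growth, so the exponential appears only once in the conclusion and the forcing
contributes only a factor `N`. -/
theorem discrete_gronwall {a : ℕ → ℝ} {N : ℕ} {c β : ℝ} (hc : 0 ≤ c) (hβ : 0 ≤ β)
    (h0 : 0 ≤ a 0)
    (h : ∀ n < N, a (n + 1) ≤ (1 + c) * a n + Real.exp (c * (n + 1)) * β) :
    a N ≤ Real.exp (c * N) * (a 0 + N * β) := by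
  induction N with
  | zero => simp
  | succ N ih =>
    have h1 := ih fun n hn => h n (by omega)
    have h2 := h N (by omega)
    have h3 : 1 + c ≤ Real.exp c := by linarith [Real.add_one_le_exp c]
    have h4 : 0 ≤ Real.exp (c * N) * (a 0 + N * β) := by positivity
    calc a (N + 1) ≤ (1 + c) * (Real.exp (c * N) * (a 0 + N * β)) +
          Real.exp (c * (N + 1)) * β := by nlinarith
      _ ≤ Real.exp c * (Real.exp (c * N) * (a 0 + N * β)) + Real.exp (c * (N + 1)) * β := by gcongr
      _ = _ := by push_cast; rw [mul_add c, Real.exp_add]; ring_nf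

/-! ### Velocity bounds uniform in the stiffness, and the guiding center. -/

section Orbit

variable {E : ℝ → Plane → Plane} {K L M ε h : ℝ} {x v : ℕ → Plane}

/-- The velocity corrected by its guiding-center value grows at rate `K`, whatever `ε`. -/
theorem IsOrbit.norm_corrected_velocity_le (ho : IsOrbit ε h E x v) (hb : FieldBounds E K L M)
    (hε : 0 < ε) (hh : 0 ≤ h) (n : ℕ) :
    ‖v n + ε • perp (E (n * h) (x n))‖ ≤
      Real.exp (K * (n * h)) * (‖v 0‖ + ε * M + n * h * (ε * (L + K * M))) := by
  have hK := hb.K_nonneg; have hL := hb.L_nonneg; have hM := hb.M_nonneg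
  have key := discrete_gronwall (a := fun n => ‖v n + ε • perp (E (n * h) (x n))‖) (N := n)
    (c := K * h) (β := h * (ε * (L + K * M))) (by positivity) (by positivity) (norm_nonneg _) ?_
  · refine key.trans (le_of_eq_of_le (b := Real.exp (K * (n * h)) *
      (‖v 0 + ε • perp (E ((0 : ℕ) * h) (x 0))‖ + n * h * (ε * (L + K * M)))) (by ring_nf) ?_)
    gcongr
    refine (norm_add_le _ _).trans ?_
    rw [norm_smul, norm_perp, Real.norm_of_nonneg hε.le]
    gcongr
    exact hb.size _ (by simp) _
  intro k _
  have hk : (0 : ℝ) ≤ k * h := by positivity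
  have hk1 : (0 : ℝ) ≤ (k + 1 : ℕ) * h := by positivity
  set e := E (k * h) (x k)
  set e' := E ((k + 1 : ℕ) * h) (x (k + 1))
  have hv := ho.vel k
  have hlam : ε * (h / ε ^ 2) = h / ε := by field_simp
  -- With the field frozen at `e`, the shift by `ε e^⊥` absorbs the forcing term, and the step
  -- becomes the pure implicit rotation, which is nonexpansive.
  have h1 : ‖v (k + 1) + ε • perp e‖ ≤ ‖v k + ε • perp e‖ := by
    refine (norm_le_norm_add_smul_perp (h / ε ^ 2) _).trans (le_of_eq ?_)
    congr 1
    rw [perp_add, perp_smul, perp_perp]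
    rw [← hlam] at hv
    linear_combination (norm := module) hv
  have h2 : ‖v (k + 1)‖ ≤ ‖v k + ε • perp e‖ + ε * M := by
    calc ‖v (k + 1)‖ = ‖(v (k + 1) + ε • perp e) - ε • perp e‖ := by simp
      _ ≤ ‖v (k + 1) + ε • perp e‖ + ‖ε • perp e‖ := norm_sub_le _ _
      _ ≤ _ := by
        rw [norm_smul, norm_perp, Real.norm_of_nonneg hε.le]
        gcongr
        exact hb.size _ hk _
  have h3 : ‖e' - e‖ ≤ L * h + K * (h / ε * ‖v (k + 1)‖) := by
    refine (hb.norm_sub_le hk1 hk _ _).trans (le_of_eq ?_)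
    rw [ho.pos k, add_sub_cancel_left, norm_smul, Real.norm_of_nonneg (by positivity),
      show ((k + 1 : ℕ) : ℝ) * h - k * h = h by push_cast; ring, abs_of_nonneg hh]
  have h4 : ‖v (k + 1) + ε • perp e'‖ ≤ ‖v (k + 1) + ε • perp e‖ + ε * ‖e' - e‖ := by
    calc ‖v (k + 1) + ε • perp e'‖ = ‖(v (k + 1) + ε • perp e) + ε • perp (e' - e)‖ := by
          rw [perp_sub]; congr 1; module
      _ ≤ _ := by
        refine (norm_add_le _ _).trans ?_
        rw [norm_smul, norm_perp, Real.norm_of_nonneg hε.le]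
  -- The weight `ε` cancels the `1 / ε` in the displacement of `x`, which is why the growth rate is
  -- `K` and not `K / ε`.
  have h5 : ε * ‖e' - e‖ ≤ ε * (L * h) + K * h * (‖v k + ε • perp e‖ + ε * M) := by
    calc ε * ‖e' - e‖ ≤ ε * (L * h + K * (h / ε * ‖v (k + 1)‖)) := by gcongr
      _ = ε * (L * h) + K * h * ‖v (k + 1)‖ := by field_simp
      _ ≤ _ := by gcongr
  have h6 : 1 ≤ Real.exp (K * h * (k + 1)) := Real.one_le_exp (by positivity)
  have h7 : h * (ε * (L + K * M)) ≤ Real.exp (K * h * (k + 1)) * (h * (ε * (L + K * M))) :=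
    le_mul_of_one_le_left (by positivity) h6
  linarith

/-- The exponential is taken at `S` and the affine factor at a larger `T`: one constant `W` then
serves all steps, and only the exponential depends on the step, in the form that `discrete_gronwall`
accepts. -/
theorem IsOrbit.norm_velocity_le (ho : IsOrbit ε h E x v) (hb : FieldBounds E K L M)
    (hε : 0 < ε) (hh : 0 ≤ h) {n : ℕ} {S T : ℝ} (hn : n * h ≤ S) (hST : S ≤ T) :
    ‖v n‖ ≤ Real.exp (K * S) * (‖v 0‖ + 2 * ε * M + T * (ε * (L + K * M))) := by
  have hK := hb.K_nonneg; have hL := hb.L_nonneg; have hM := hb.M_nonneg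
  have hn0 : 0 ≤ n * h := by positivity
  have h1 : 1 ≤ Real.exp (K * (n * h)) := Real.one_le_exp (by positivity)
  calc ‖v n‖ = ‖(v n + ε • perp (E (n * h) (x n))) - ε • perp (E (n * h) (x n))‖ := by simp
    _ ≤ ‖v n + ε • perp (E (n * h) (x n))‖ + ‖ε • perp (E (n * h) (x n))‖ := norm_sub_le _ _
    _ ≤ Real.exp (K * (n * h)) * (‖v 0‖ + ε * M + n * h * (ε * (L + K * M))) +
        Real.exp (K * (n * h)) * (ε * M) := by
      refine add_le_add (ho.norm_corrected_velocity_le hb hε hh n) ?_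
      rw [norm_smul, norm_perp, Real.norm_of_nonneg hε.le]
      refine le_trans ?_ (le_mul_of_one_le_left (by positivity) h1)
      gcongr
      exact hb.size _ hn0 _
    _ = Real.exp (K * (n * h)) * (‖v 0‖ + 2 * ε * M + n * h * (ε * (L + K * M))) := by ring
    _ ≤ _ := by
      have := hn.trans hST
      gcongr

/-- The guiding center `x - ε v^⊥` follows the explicit Euler scheme of the field `-E^⊥`. -/
theorem IsOrbit.guidingCenter_succ (ho : IsOrbit ε h E x v) (hε : 0 < ε) (n : ℕ) :
    x (n + 1) - ε • perp (v (n + 1)) =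
      x n - ε • perp (v n) - h • perp (E (n * h) (x n)) := by
  have h1 := ho.pos n
  have h2 := congrArg (fun u => ε • perp u) (ho.vel n)
  simp only [perp_add, perp_smul, perp_perp, smul_add, smul_smul] at h2
  rw [show ε * (h / ε ^ 2) = h / ε by field_simp, show ε * (h / ε) = h by field_simp] at h2
  rw [h1]
  linear_combination (norm := module) -h2

theorem norm_sub_le_norm_guidingCenter_sub (hε : 0 < ε) (x y v w : Plane) :
    ‖x - y‖ ≤ ‖(x - ε • perp v) - (y - ε • perp w)‖ + ε * ‖v - w‖ := by
  calc ‖x - y‖ = ‖((x - ε • perp v) - (y - ε • perp w)) + ε • perp (v - w)‖ := by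
        rw [perp_sub]; congr 1; module
    _ ≤ _ := by
      refine (norm_add_le _ _).trans ?_
      rw [norm_smul, norm_perp, Real.norm_of_nonneg hε.le]

end Orbit

/-! ### Consistency of `m` small steps with one large step. -/

section Window

variable {E : ℝ → Plane → Plane} {K L M ε h : ℝ} {x v : ℕ → Plane} {a m : ℕ} {Vb : ℝ}

theorem IsOrbit.norm_pos_sub_le (ho : IsOrbit ε h E x v) (hε : 0 < ε) (hh : 0 ≤ h)
    (hV : ∀ j ≤ a + m, ‖v j‖ ≤ Vb) {i : ℕ} (hi : i ≤ m) :
    ‖x (a + i) - x a‖ ≤ m * h / ε * Vb := by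
  have hVb : 0 ≤ Vb := (norm_nonneg _).trans (hV 0 (by omega))
  refine (norm_sub_le_nsmul (c := h / ε * Vb) fun j hj => ?_).trans ?_
  · rw [ho.pos, add_sub_cancel_left, norm_smul, Real.norm_of_nonneg (by positivity)]
    gcongr
    exact hV _ (by omega)
  · rw [← mul_assoc, ← mul_div_assoc]
    gcongr

theorem IsOrbit.norm_field_sub_le (ho : IsOrbit ε h E x v) (hb : FieldBounds E K L M)
    (hε : 0 < ε) (hh : 0 ≤ h)
    (hV : ∀ j ≤ a + m, ‖v j‖ ≤ Vb) {i : ℕ} (hi : i ≤ m) :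
    ‖E ((a + i : ℕ) * h) (x (a + i)) - E (a * h) (x a)‖ ≤
      L * (m * h) + K * (m * h / ε * Vb) := by
  have := hb.K_nonneg; have := hb.L_nonneg
  refine (hb.norm_sub_le (by positivity) (by positivity) _ _).trans ?_
  gcongr
  · rw [show ((a + i : ℕ) : ℝ) * h - a * h = i * h by push_cast; ring,
      abs_of_nonneg (by positivity)]
    gcongr
  · exact ho.norm_pos_sub_le hε hh hV hi

theorem IsOrbit.norm_velocity_succ_sub_le (ho : IsOrbit ε h E x v) (hb : FieldBounds E K L M)
    (hε : 0 < ε) (hh : 0 ≤ h) {n : ℕ} (hV : ‖v (n + 1)‖ ≤ Vb) :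
    ‖v (n + 1) - v n‖ ≤ h * (M / ε + Vb / ε ^ 2) := by
  have h1 : v (n + 1) - v n =
      (h / ε) • E (n * h) (x n) - (h / ε ^ 2) • perp (v (n + 1)) := by
    linear_combination (norm := module) ho.vel n
  have hM := hb.M_nonneg
  rw [h1]
  refine (norm_sub_le _ _).trans ?_
  rw [norm_smul, norm_smul, norm_perp, Real.norm_of_nonneg (by positivity),
    Real.norm_of_nonneg (by positivity)]
  calc h / ε * ‖E (n * h) (x n)‖ + h / ε ^ 2 * ‖v (n + 1)‖ ≤ h / ε * M + h / ε ^ 2 * Vb := by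
        gcongr
        exact hb.size _ (by positivity) _
    _ = _ := by ring

/-- Consistency of `m` steps of size `h` with one step of size `m h`, for the guiding center. -/
theorem IsOrbit.norm_guidingCenter_defect_le (ho : IsOrbit ε h E x v) (hε : 0 < ε) (hh : 0 ≤ h)
    {e : Plane} {c : ℝ}
    (hc : ∀ i < m, ‖E ((a + i : ℕ) * h) (x (a + i)) - e‖ ≤ c) :
    ‖(x (a + m) - ε • perp (v (a + m))) - (x a - ε • perp (v a)) + (m * h) • perp e‖ ≤
      m * h * c := by
  have := norm_sub_sub_nsmul_le (u := fun n => x n - ε • perp (v n)) (a := a) (m := m)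
    (d := -(h • perp e)) (c := h * c) fun i hi => ?_
  · refine le_of_eq_of_le ?_ (this.trans_eq (by ring))
    congr 1
    module
  · rw [ho.guidingCenter_succ hε]
    rw [show x (a + i) - ε • perp (v (a + i)) - h • perp (E ((a + i : ℕ) * h) (x (a + i))) -
      (x (a + i) - ε • perp (v (a + i))) - -(h • perp e) =
        -(h • perp (E ((a + i : ℕ) * h) (x (a + i)) - e)) by rw [perp_sub]; module,
      norm_neg, norm_smul, norm_perp, Real.norm_of_nonneg hh]
    gcongr
    exact hc i hi

/-- Consistency of `m` steps of size `h` with one step of size `m h`, for the velocity. -/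
theorem IsOrbit.norm_velocity_defect_le (ho : IsOrbit ε h E x v) (hb : FieldBounds E K L M)
    (hε : 0 < ε) (hh : 0 ≤ h) (hV : ∀ j ≤ a + m, ‖v j‖ ≤ Vb) :
    ‖v (a + m) + (m * h / ε ^ 2) • perp (v (a + m)) - v a - (m * h / ε) • E (a * h) (x a)‖ ≤
      m * h / ε * (L * (m * h) + K * (m * h / ε * Vb)) +
        m * h / ε ^ 2 * (m * h * (M / ε + Vb / ε ^ 2)) := by
  have hM := hb.M_nonneg
  have hVb : 0 ≤ Vb := (norm_nonneg _).trans (hV 0 (by omega))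
  -- The large step is implicit, so its rotation term sits at the end of the window; the
  -- intermediate velocities are compared with the final one.
  have hback : ∀ i < m, ‖v (a + m) - v (a + i + 1)‖ ≤ m * h * (M / ε + Vb / ε ^ 2) := by
    intro i hi
    have := norm_sub_le_nsmul (u := v) (a := a + i + 1) (m := m - (i + 1))
      (c := h * (M / ε + Vb / ε ^ 2)) fun j hj =>
        ho.norm_velocity_succ_sub_le hb hε hh (hV _ (by omega))
    rw [show a + i + 1 + (m - (i + 1)) = a + m by omega] at this
    refine this.trans ?_
    rw [← mul_assoc]
    gcongr
    omega
  have := norm_sub_sub_nsmul_le (u := v) (a := a) (m := m)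
    (d := (h / ε) • E (a * h) (x a) - (h / ε ^ 2) • perp (v (a + m)))
    (c := h / ε * (L * (m * h) + K * (m * h / ε * Vb)) +
        h / ε ^ 2 * (m * h * (M / ε + Vb / ε ^ 2))) fun i hi => ?_
  · refine le_of_eq_of_le ?_ (this.trans_eq (by ring))
    congr 1
    module
  · have h1 : v (a + i + 1) - v (a + i) -
        ((h / ε) • E (a * h) (x a) - (h / ε ^ 2) • perp (v (a + m))) =
        (h / ε) • (E ((a + i : ℕ) * h) (x (a + i)) - E (a * h) (x a)) +
          (h / ε ^ 2) • perp (v (a + m) - v (a + i + 1)) := by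
      rw [perp_sub]
      linear_combination (norm := module) ho.vel (a + i)
    rw [h1]
    refine (norm_add_le _ _).trans ?_
    rw [norm_smul, norm_smul, norm_perp, Real.norm_of_nonneg (by positivity),
      Real.norm_of_nonneg (by positivity)]
    gcongr
    · exact ho.norm_field_sub_le hb hε hh hV hi.le
    · exact hback i hi

end Window

/-! ### Pathwise error between an orbit and its refinement. -/

section Refinement

variable {E : ℝ → Plane → Plane} {K L M ε h : ℝ} {X V x v : ℕ → Plane} {m : ℕ}

/-- Error between an orbit and its `m`-fold refinement, sharp when the step resolves the
gyration. -/
theorem IsOrbit.norm_refinement_sub_le (hO : IsOrbit ε (m * h) E X V) (ho : IsOrbit ε h E x v)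
    (hx : X 0 = x 0) (hv : V 0 = v 0)
    (hb : FieldBounds E K L M) (hε : 0 < ε) (hh : 0 ≤ h) {N : ℕ} {T W : ℝ}
    (hT : N * (m * h) = T) (hW : ‖v 0‖ + 2 * ε * M + T * (ε * (L + K * M)) = W) :
    ‖X N - x (N * m)‖ ≤ Real.exp (2 * K * T) *
      (T * (m * h) * (2 * (L + K * W / ε) + M / ε ^ 2 + W / ε ^ 3)) := by
  have hK := hb.K_nonneg; have hL := hb.L_nonneg; have hM := hb.M_nonneg
  have hT0 : 0 ≤ T := hT ▸ by positivity
  have hW0 : 0 ≤ W := hW ▸ by positivity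
  set H : ℝ := m * h with hH
  have hH0 : 0 ≤ H := by positivity
  -- The velocity error is weighted by `ε` so that `D` controls the position error and the feedback
  -- `H / ε * (K * D n)` becomes `H * (K * D n)`. Guiding center and velocity each contribute one
  -- such term, hence the rate `2 K`.
  set D : ℕ → ℝ := fun n => ‖(X n - ε • perp (V n)) -
    (x (n * m) - ε • perp (v (n * m)))‖ + ε * ‖V n - v (n * m)‖ with hD
  have hXD : ∀ n, ‖X n - x (n * m)‖ ≤ D n := fun n =>
    norm_sub_le_norm_guidingCenter_sub hε _ _ _ _
  have key := discrete_gronwall (a := D) (N := N) (c := 2 * K * H)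
    (β := H ^ 2 * (2 * (L + K * W / ε) + M / ε ^ 2 + W / ε ^ 3)) (by positivity) (by positivity)
    (by positivity) ?_
  · refine (hXD N).trans (key.trans (le_of_eq ?_))
    simp only [hD, hx, hv, zero_mul, sub_self, norm_zero, mul_zero, add_zero, zero_add, ← hT]
    ring_nf
  intro n hn
  set e := E ((n * m : ℕ) * h) (x (n * m)) with he
  set e' := E (n * H) (X n) with he'
  set Vb := Real.exp (K * ((n + 1 : ℕ) * H)) * W with hVb
  have hVb0 : 0 ≤ Vb := by positivity
  have hbound : ∀ j ≤ n * m + m, ‖v j‖ ≤ Vb := by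
    intro j hj
    have hj' : (j : ℝ) ≤ ((n + 1) * m : ℕ) := by
      exact_mod_cast hj.trans_eq (by ring)
    rw [hVb, ← hW]
    refine ho.norm_velocity_le hb hε hh ?_ ?_
    · rw [hH, ← mul_assoc]
      push_cast at hj' ⊢
      gcongr
    · rw [← hT]
      gcongr
      omega
  have hw := ho.norm_guidingCenter_defect_le (E := E) (m := m) (a := n * m) (e := e) hε hh
    fun i hi => ho.norm_field_sub_le hb hε hh hbound hi.le
  have hv' := ho.norm_velocity_defect_le hb hε hh hbound
  have hee : ‖e' - e‖ ≤ K * D n := by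
    have : ((n * m : ℕ) : ℝ) * h = n * H := by push_cast; ring
    rw [he, he', this]
    exact (hb.space _ (by positivity) _ _).trans (by gcongr; exact hXD n)
  rw [← hH] at hw hv'
  have hidx : (n + 1) * m = n * m + m := by ring
  have hW1 : ‖(X (n + 1) - ε • perp (V (n + 1))) -
      (x ((n + 1) * m) - ε • perp (v ((n + 1) * m)))‖ ≤
      ‖(X n - ε • perp (V n)) - (x (n * m) - ε • perp (v (n * m)))‖ + H * (K * D n) +
        H * (L * H + K * (H / ε * Vb)) := by
    rw [hO.guidingCenter_succ hε, hidx]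
    calc _ = ‖((X n - ε • perp (V n)) - (x (n * m) - ε • perp (v (n * m)))) +
          -(H • perp (e' - e)) + -(x (n * m + m) - ε • perp (v (n * m + m)) -
            (x (n * m) - ε • perp (v (n * m))) + H • perp e)‖ := by
          rw [perp_sub]; congr 1; module
      _ ≤ _ := by
        refine (norm_add₃_le).trans ?_
        rw [norm_neg, norm_neg, norm_smul, norm_perp, Real.norm_of_nonneg hH0]
        gcongr
  have hV1 : ‖V (n + 1) - v ((n + 1) * m)‖ ≤ ‖V n - v (n * m)‖ + H / ε * (K * D n) +
      (H / ε * (L * H + K * (H / ε * Vb)) + H / ε ^ 2 * (H * (M / ε + Vb / ε ^ 2))) := by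
    refine (norm_le_norm_add_smul_perp (H / ε ^ 2) _).trans ?_
    rw [hidx]
    have hvel := hO.vel n
    calc _ = ‖(V n - v (n * m)) + (H / ε) • (e' - e) + -(v (n * m + m) +
          (H / ε ^ 2) • perp (v (n * m + m)) - v (n * m) - (H / ε) • e)‖ := by
          rw [perp_sub]; congr 1
          linear_combination (norm := module) hvel
      _ ≤ _ := by
        refine (norm_add₃_le).trans ?_
        rw [norm_neg, norm_smul, Real.norm_of_nonneg (by positivity)]
        gcongr
  have hV1' : ε * ‖V (n + 1) - v ((n + 1) * m)‖ ≤ ε * ‖V n - v (n * m)‖ + H * (K * D n) +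
      (H * (L * H + K * (H / ε * Vb)) + H ^ 2 * (M / ε ^ 2 + Vb / ε ^ 3)) := by
    calc _ ≤ ε * _ := mul_le_mul_of_nonneg_left hV1 hε.le
      _ = _ := by field_simp
  have hexp1 : 1 ≤ Real.exp (2 * K * H * (n + 1)) := Real.one_le_exp (by positivity)
  have hexp2 : Real.exp (K * ((n + 1 : ℕ) * H)) ≤ Real.exp (2 * K * H * (n + 1)) := by
    apply Real.exp_le_exp.mpr
    push_cast
    have : 0 ≤ K * H * (n + 1) := by positivity
    linarith
  have hVb' : Vb ≤ Real.exp (2 * K * H * (n + 1)) * W := by rw [hVb]; gcongr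
  generalize Real.exp (2 * K * H * (n + 1)) = G at *
  calc D (n + 1) ≤ (1 + 2 * K * H) * D n +
        H ^ 2 * (2 * (L + K * Vb / ε) + M / ε ^ 2 + Vb / ε ^ 3) := by
        refine (add_le_add hW1 hV1').trans (le_of_eq ?_)
        simp only [hD]
        ring
    _ ≤ (1 + 2 * K * H) * D n +
        H ^ 2 * (2 * (G * L + K * (G * W) / ε) + G * M / ε ^ 2 + G * W / ε ^ 3) := by
        gcongr
        · exact le_mul_of_one_le_left hL hexp1
        · exact le_mul_of_one_le_left hM hexp1
    _ = _ := by ring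

/-- Error between an orbit and its `m`-fold refinement through their common guiding-center limit,
uniform in the stiffness. -/
theorem IsOrbit.norm_refinement_sub_le_uniform (hO : IsOrbit ε (m * h) E X V)
    (ho : IsOrbit ε h E x v) (hx : X 0 = x 0) (hv : V 0 = v 0)
    (hb : FieldBounds E K L M) (hε : 0 < ε) (hh : 0 ≤ h) {N : ℕ} {T W : ℝ}
    (hT : N * (m * h) = T) (hW : ‖v 0‖ + 2 * ε * M + T * (ε * (L + K * M)) = W) :
    ‖X N - x (N * m)‖ ≤ Real.exp (2 * K * T) *
      (T * ((L + K * M) * (m * h) + 2 * K * ε * W) + 2 * ε * W) := by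
  have hK := hb.K_nonneg; have hL := hb.L_nonneg; have hM := hb.M_nonneg
  have hT0 : 0 ≤ T := hT ▸ by positivity
  have hW0 : 0 ≤ W := hW ▸ by positivity
  set H : ℝ := m * h with hH
  have hH0 : 0 ≤ H := by positivity
  have hvb : ∀ n ≤ N, ∀ j ≤ n * m, ‖v j‖ ≤ Real.exp (K * (n * H)) * W := by
    intro n hn j hj
    have hj' : (j : ℝ) ≤ (n * m : ℕ) := by exact_mod_cast hj
    rw [← hW]
    refine ho.norm_velocity_le hb hε hh ?_ ?_
    · rw [hH, ← mul_assoc]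
      push_cast at hj' ⊢
      gcongr
    · rw [← hT]
      gcongr
  have hVb : ∀ n ≤ N, ∀ j ≤ n, ‖V j‖ ≤ Real.exp (K * (n * H)) * W := by
    intro n hn j hj
    have hj' : (j : ℝ) ≤ n := by exact_mod_cast hj
    rw [← hW, ← hv]
    refine hO.norm_velocity_le hb hε hH0 ?_ ?_
    · gcongr
    · rw [← hT]
      gcongr
  -- Only guiding centers are compared here. The velocity difference enters through its size,
  -- multiplied by `ε`, so no consistency in the stiff variable is needed.
  set D : ℕ → ℝ := fun n => ‖(X n - ε • perp (V n)) -
    (x (n * m) - ε • perp (v (n * m)))‖ with hD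
  have key := discrete_gronwall (a := D) (N := N) (c := K * H)
    (β := H * ((L + K * M) * H + 2 * K * ε * W)) (by positivity) (by positivity)
    (by positivity) ?_
  · have hXD := norm_sub_le_norm_guidingCenter_sub hε (X N) (x (N * m)) (V N) (v (N * m))
    have h1 : ‖V N - v (N * m)‖ ≤ 2 * (Real.exp (K * T) * W) := by
      refine (norm_sub_le _ _).trans ?_
      have := hVb N le_rfl N le_rfl
      have := hvb N le_rfl _ le_rfl
      rw [hT] at *
      linarith
    have h2 : D N ≤ Real.exp (K * T) * (T * ((L + K * M) * H + 2 * K * ε * W)) := by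
      refine key.trans (le_of_eq ?_)
      simp only [hD, hx, hv, zero_mul, sub_self, norm_zero, zero_add, ← hT]
      ring_nf
    calc ‖X N - x (N * m)‖ ≤ Real.exp (K * T) * (T * ((L + K * M) * H + 2 * K * ε * W)) +
          ε * (2 * (Real.exp (K * T) * W)) := hXD.trans (by gcongr)
      _ = Real.exp (K * T) * (T * ((L + K * M) * H + 2 * K * ε * W) + 2 * ε * W) := by ring
      _ ≤ _ := by
        gcongr
        linarith
  intro n hn
  set e' := E (n * H) (X n) with he'
  set G := Real.exp (K * H * (n + 1)) with hG
  have hG1 : 1 ≤ G := Real.one_le_exp (by positivity)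
  have hGeq : Real.exp (K * ((n + 1 : ℕ) * H)) = G := by rw [hG]; push_cast; ring_nf
  have hidx : (n + 1) * m = n * m + m := by ring
  have hvb' := hvb (n + 1) hn
  have hVb' := hVb (n + 1) hn
  rw [hGeq] at hvb' hVb'
  have hcast : ((n * m : ℕ) : ℝ) * h = n * H := by push_cast; ring
  -- Within a window the guiding center moves at speed at most `M`, whereas `x` itself may move at
  -- speed `‖v‖ / ε`.
  have hdrift : ∀ i ≤ m, ‖(x (n * m + i) - ε • perp (v (n * m + i))) -
      (x (n * m) - ε • perp (v (n * m)))‖ ≤ H * M := by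
    intro i hi
    refine (norm_sub_le_nsmul (u := fun j => x j - ε • perp (v j)) (a := n * m) (m := i)
      (c := h * M) fun j hj => ?_).trans ?_
    · rw [ho.guidingCenter_succ hε, sub_sub_cancel_left, norm_neg, norm_smul, norm_perp,
        Real.norm_of_nonneg hh]
      gcongr
      exact hb.size _ (by positivity) _
    · rw [hH, ← mul_assoc]
      gcongr
  have hfield : ∀ i < m, ‖E ((n * m + i : ℕ) * h) (x (n * m + i)) - e'‖ ≤
      L * H + K * (H * M + D n + 2 * ε * (G * W)) := by
    intro i hi
    refine (hb.norm_sub_le (by positivity) (by positivity) _ _).trans ?_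
    gcongr
    · rw [← hcast, show ((n * m + i : ℕ) : ℝ) * h - (n * m : ℕ) * h = i * h by push_cast; ring,
        abs_of_nonneg (by positivity), hH]
      gcongr
    · refine (norm_sub_le_norm_guidingCenter_sub hε _ _ (v (n * m + i)) (V n)).trans ?_
      have h1 := norm_sub_le_norm_sub_add_norm_sub
        (x (n * m + i) - ε • perp (v (n * m + i))) (x (n * m) - ε • perp (v (n * m)))
        (X n - ε • perp (V n))
      have h2 := hdrift i hi.le
      have h3 : ‖v (n * m + i) - V n‖ ≤ 2 * (G * W) := by
        refine (norm_sub_le _ _).trans ?_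
        have := hvb' (n * m + i) (by rw [hidx]; omega)
        have := hVb' n (by omega)
        linarith
      have h4 : ε * ‖v (n * m + i) - V n‖ ≤ ε * (2 * (G * W)) := by gcongr
      rw [norm_sub_rev (x (n * m) - ε • perp (v (n * m)))] at h1
      simp only [hD]
      linarith
  have hw := ho.norm_guidingCenter_defect_le hε hh hfield
  rw [← hH] at hw
  have hW1 : D (n + 1) ≤ D n + H * (L * H + K * (H * M + D n + 2 * ε * (G * W))) := by
    simp only [hD]
    rw [hO.guidingCenter_succ hε, hidx]
    calc _ = ‖((X n - ε • perp (V n)) - (x (n * m) - ε • perp (v (n * m)))) +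
          -(x (n * m + m) - ε • perp (v (n * m + m)) -
            (x (n * m) - ε • perp (v (n * m))) + H • perp e')‖ := by
          congr 1; module
      _ ≤ _ := by
        refine (norm_add_le _ _).trans ?_
        rw [norm_neg]
        gcongr
  have h2 : H * ((L + K * M) * H) ≤ G * (H * ((L + K * M) * H)) :=
    le_mul_of_one_le_left (by positivity) hG1
  linarith

end Refinement

/-! ### Collecting the constants. -/

/-- The left side is the stiff error coefficient multiplied by `ε³`. Since `P` dominates both `1`
and `ε`, every power of `ε` is absorbed by `(1 + ε²) P`. -/
theorem stiff_sum_le {K L M c ε T P W : ℝ} (hK : 0 ≤ K) (hL : 0 ≤ L) (hM : 0 ≤ M) (hc : 0 ≤ c)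
    (hε : 0 < ε) (hT : 0 ≤ T) (hP : 1 ≤ P) (hεP : ε ≤ P) (hW : W ≤ c * (1 + T) * P) :
    2 * L * ε ^ 3 + 2 * K * ε ^ 2 * W + M * ε + W ≤
      (2 * L + 2 * K * c + M + c) * ((1 + ε ^ 2) * ((1 + T) * P)) := by
  have hε1 : 1 ≤ 1 + ε ^ 2 := by linarith [sq_nonneg ε]
  have hQ : P ≤ (1 + T) * P := le_mul_of_one_le_left (by linarith) (by linarith)
  have hQ0 : 0 ≤ (1 + T) * P := by linarith
  have i1 : ε ^ 2 * ε ≤ (1 + ε ^ 2) * ((1 + T) * P) :=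
    mul_le_mul (by linarith) (hεP.trans hQ) hε.le (by linarith)
  have i2 : ε ^ 2 * W ≤ (1 + ε ^ 2) * (c * ((1 + T) * P)) :=
    (mul_le_mul_of_nonneg_left (hW.trans_eq (mul_assoc _ _ _)) (sq_nonneg ε)).trans
      (mul_le_mul_of_nonneg_right (by linarith) (mul_nonneg hc hQ0))
  have i3 : ε ≤ (1 + ε ^ 2) * ((1 + T) * P) :=
    (hεP.trans hQ).trans (le_mul_of_one_le_left hQ0 hε1)
  have i4 : W ≤ (1 + ε ^ 2) * (c * ((1 + T) * P)) :=
    (hW.trans_eq (mul_assoc _ _ _)).trans (le_mul_of_one_le_left (mul_nonneg hc hQ0) hε1)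
  have j1 := mul_le_mul_of_nonneg_left i1 (by linarith : 0 ≤ 2 * L)
  have j2 := mul_le_mul_of_nonneg_left i2 (by linarith : 0 ≤ 2 * K)
  have j3 := mul_le_mul_of_nonneg_left i3 hM
  linear_combination j1 + j2 + j3 + i4

theorem uniform_sum_le {K L M c ε H T P W : ℝ} (hK : 0 ≤ K) (hL : 0 ≤ L) (hM : 0 ≤ M)
    (hε : 0 < ε) (hH : 0 ≤ H) (hT : 0 ≤ T) (hP : 1 ≤ P) (hW0 : 0 ≤ W)
    (hW : W ≤ c * (1 + T) * P) :
    T * ((L + K * M) * H + 2 * K * ε * W) + 2 * ε * W ≤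
      (L + K * M + 2 * K * c + 2 * c) * (H + ε) * (1 + T) ^ 2 * P := by
  have hTsq : T ≤ (1 + T) ^ 2 := by linear_combination hT + sq_nonneg T
  have i1 : T * H ≤ (1 + T) ^ 2 * (H + ε) * P :=
    (mul_le_mul hTsq (by linarith) hH (by positivity)).trans
      (le_mul_of_one_le_right (by positivity) hP)
  have i2 : T * ε * W ≤ (1 + T) * (H + ε) * (c * (1 + T) * P) :=
    mul_le_mul (mul_le_mul (by linarith) (by linarith) hε.le (by linarith)) hW hW0 (by positivity)
  have i3 : ε * W ≤ (1 + T) * (H + ε) * (c * (1 + T) * P) := by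
    refine mul_le_mul ?_ hW hW0 (by positivity)
    linarith [mul_nonneg hT hH, mul_nonneg hT hε.le]
  have j1 := mul_le_mul_of_nonneg_left i1 (by positivity : 0 ≤ L + K * M)
  have j2 := mul_le_mul_of_nonneg_left i2 (by positivity : 0 ≤ 2 * K)
  linear_combination j1 + j2 + 2 * i3

/-- A common bound for the two refinement errors, with a constant independent of `ε`, of the step
and of the number of substeps. -/
theorem exists_refinement_bound {E : ℝ → Plane → Plane} {K L M : ℝ} (hb : FieldBounds E K L M) :
    ∃ C, 0 < C ∧ ∀ (ε h : ℝ) (m N : ℕ) (X V x v : ℕ → Plane), 0 < ε → 0 ≤ h →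
      IsOrbit ε (m * h) E X V → IsOrbit ε h E x v → X 0 = x 0 → V 0 = v 0 →
      ‖X N - x (N * m)‖ ≤ C * min (m * h / ε ^ 3 * (1 + ε ^ 2)) (m * h + ε) *
        Real.exp (2 * K * (N * (m * h))) * (1 + (N * (m * h)) ^ 2) * (1 + ε + ‖v 0‖) := by
  have hK := hb.K_nonneg; have hL := hb.L_nonneg; have hM := hb.M_nonneg
  set c := 1 + 2 * M + L + K * M with hc
  have hc1 : 0 < c := by positivity
  set A := 2 * L + 2 * K * c + M + c with hA
  set B := L + K * M + 2 * K * c + 2 * c with hB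
  have hA0 : 0 ≤ A := by positivity
  have hB0 : 0 ≤ B := by positivity
  -- The factor `2` comes from bounding `T (1 + T)` and `(1 + T)²` by `2 (1 + T²)`; the summand `1`
  -- secures positivity.
  refine ⟨2 * (A + B) + 1, by positivity, ?_⟩
  intro ε h m N X V x v hε hh hO ho hx hv
  have key1 := hO.norm_refinement_sub_le ho hx hv hb hε hh (N := N) rfl rfl
  have key2 := hO.norm_refinement_sub_le_uniform ho hx hv hb hε hh (N := N) rfl rfl
  set H : ℝ := m * h with hH
  have hH0 : 0 ≤ H := by positivity
  set T : ℝ := N * H with hT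
  have hT0 : 0 ≤ T := by positivity
  set W := ‖v 0‖ + 2 * ε * M + T * (ε * (L + K * M)) with hW
  have hv0 : 0 ≤ ‖v 0‖ := norm_nonneg _
  set r := ‖v 0‖
  set P := 1 + ε + r with hP
  have hP1 : 1 ≤ P := by linarith
  have hWle : W ≤ c * (1 + T) * (ε + r) := by
    have : c * (1 + T) * (ε + r) - W = r * (2 * M + L + K * M) + c * T * r + ε * (1 + L + K * M) +
        T * ε * (1 + 2 * M) := by
      rw [hW, hc]; ring
    have h0 : 0 ≤ r * (2 * M + L + K * M) + c * T * r + ε * (1 + L + K * M) +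
        T * ε * (1 + 2 * M) := by positivity
    linarith
  have hWle' : W ≤ c * (1 + T) * P := hWle.trans (by gcongr; linarith)
  have hW0 : 0 ≤ W := by positivity
  have hT1 : T * (1 + T) ≤ 2 * (1 + T ^ 2) := by nlinarith [sq_nonneg (T - 1)]
  have hT2 : (1 + T) ^ 2 ≤ 2 * (1 + T ^ 2) := by nlinarith [sq_nonneg (T - 1)]
  set G := Real.exp (2 * K * T)
  have hG : 0 < G := Real.exp_pos _
  have hbound1 : ‖X N - x (N * m)‖ ≤ 2 * A * (H / ε ^ 3 * (1 + ε ^ 2)) * G * (1 + T ^ 2) * P := by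
    have h1 : 2 * (L + K * W / ε) + M / ε ^ 2 + W / ε ^ 3 =
        (2 * L * ε ^ 3 + 2 * K * ε ^ 2 * W + M * ε + W) / ε ^ 3 := by field_simp
    have h2 := stiff_sum_le hK hL hM hc1.le hε hT0 hP1 (by linarith) hWle'
    rw [← hA] at h2
    calc ‖X N - x (N * m)‖ ≤ G * (T * H * ((2 * L * ε ^ 3 + 2 * K * ε ^ 2 * W + M * ε + W) /
          ε ^ 3)) := h1 ▸ key1
      _ ≤ G * (T * H * ((A * ((1 + ε ^ 2) * ((1 + T) * P))) / ε ^ 3)) := by gcongr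
      _ = A * (H / ε ^ 3 * (1 + ε ^ 2)) * G * (T * (1 + T)) * P := by ring
      _ ≤ A * (H / ε ^ 3 * (1 + ε ^ 2)) * G * (2 * (1 + T ^ 2)) * P := by gcongr
      _ = _ := by ring
  have hbound2 : ‖X N - x (N * m)‖ ≤ 2 * B * (H + ε) * G * (1 + T ^ 2) * P := by
    have h2 := uniform_sum_le hK hL hM hε hH0 hT0 hP1 hW0 hWle'
    rw [← hB] at h2
    calc ‖X N - x (N * m)‖ ≤ G * (T * ((L + K * M) * H + 2 * K * ε * W) + 2 * ε * W) := key2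
      _ ≤ G * (B * (H + ε) * (1 + T) ^ 2 * P) := by gcongr
      _ ≤ G * (B * (H + ε) * (2 * (1 + T ^ 2)) * P) := by gcongr
      _ = _ := by ring
  rcases min_choice (H / ε ^ 3 * (1 + ε ^ 2)) (H + ε) with hmin | hmin <;> rw [hmin]
  · refine hbound1.trans ?_
    gcongr
    linarith
  · refine hbound2.trans ?_
    gcongr
    linarith

/-! ### Compactly supported Lipschitz functions and their mollification. -/

section Transport

variable {V : Type*} [NormedAddCommGroup V]

/-- `φ` is `A`-Lipschitz and vanishes outside the closed ball of radius `R`. -/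
structure LipCompact (φ : V → ℝ) (A R : ℝ) : Prop where
  lip : ∀ x y, |φ x - φ y| ≤ A * ‖x - y‖
  zero : ∀ x, R < ‖x‖ → φ x = 0

namespace LipCompact

variable {φ : V → ℝ} {A R : ℝ}

theorem continuous (hφ : LipCompact φ A R) : Continuous φ :=
  (LipschitzWith.of_dist_le' (K := A) fun x y => by
    rw [Real.dist_eq, dist_eq_norm]; exact hφ.lip x y).continuous

theorem mono (hφ : LipCompact φ A R) {A' R' : ℝ} (hA : A ≤ A') (hR : R ≤ R') :
    LipCompact φ A' R' :=
  ⟨fun x y => (hφ.lip x y).trans (by gcongr), fun x hx => hφ.zero x (hR.trans_lt hx)⟩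

variable [NormedSpace ℝ V]

theorem norm_fderiv_le (hφ : LipCompact φ A R) (hA : 0 ≤ A) (x : V) : ‖fderiv ℝ φ x‖ ≤ A :=
  norm_fderiv_le_of_lip' ℝ hA (Filter.Eventually.of_forall fun y => hφ.lip y x)

theorem fderiv_zero (hφ : LipCompact φ A R) {x : V} (hx : R < ‖x‖) : fderiv ℝ φ x = 0 := by
  have : φ =ᶠ[nhds x] fun _ => 0 := by
    filter_upwards [(isOpen_lt continuous_const continuous_norm).mem_nhds hx] with y hy
    exact hφ.zero y hy
  rw [this.fderiv_eq]
  simp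

variable [FiniteDimensional ℝ V]

theorem hasCompactSupport (hφ : LipCompact φ A R) : HasCompactSupport φ := by
  have := FiniteDimensional.proper_real V
  refine HasCompactSupport.intro (isCompact_closedBall (0 : V) R) fun x hx => hφ.zero x ?_
  simpa using hx

theorem integrable (hφ : LipCompact φ A R) [MeasurableSpace V] [BorelSpace V] (ν : Measure V)
    [IsFiniteMeasureOnCompacts ν] : Integrable φ ν :=
  hφ.continuous.integrable_of_hasCompactSupport hφ.hasCompactSupport

end LipCompact

variable [NormedSpace ℝ V] [FiniteDimensional ℝ V] [MeasurableSpace V] [BorelSpace V]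

/-- The convolution of `φ` with a normalized smooth bump function. -/
noncomputable def mollify (η : ContDiffBump (0 : V)) (φ : V → ℝ) (p : V) : ℝ :=
  ∫ q, η.normed Measure.addHaar q * φ (p - q) ∂Measure.addHaar

section Mollify

variable (η : ContDiffBump (0 : V)) {φ : V → ℝ} {A R : ℝ}

theorem integrable_bump_mul {F : V → ℝ} (hF : Continuous F) :
    Integrable (fun q => η.normed Measure.addHaar q * F q) Measure.addHaar :=
  (η.continuous_normed.mul hF).integrable_of_hasCompactSupport η.hasCompactSupport_normed.mul_right

theorem abs_integral_bump_mul_le {F : V → ℝ} {c : ℝ}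
    (h : ∀ q, ‖q‖ ≤ η.rOut → |F q| ≤ c) :
    |∫ q, η.normed Measure.addHaar q * F q ∂Measure.addHaar| ≤ c := by
  have h1 : ∀ q, ‖η.normed Measure.addHaar q * F q‖ ≤ η.normed Measure.addHaar q * c := by
    intro q
    rw [norm_mul, Real.norm_of_nonneg (η.nonneg_normed q)]
    by_cases hq : ‖q‖ ≤ η.rOut
    · exact mul_le_mul_of_nonneg_left (h q hq) (η.nonneg_normed q)
    · have : η.normed (Measure.addHaar : Measure V) q = 0 := by
        rw [← Function.notMem_support, η.support_normed_eq]
        simpa using (not_le.mp hq).le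
      simp [this]
  rw [← Real.norm_eq_abs]
  refine (norm_integral_le_of_norm_le (η.integrable_normed.mul_const c)
    (Filter.Eventually.of_forall h1)).trans (le_of_eq ?_)
  rw [integral_mul_const, η.integral_normed, one_mul]

/-- Two mollifications by the same bump are compared shift by shift. Allowing different functions
and base points lets the commutator of mollification with a step be estimated. -/
theorem abs_mollify_sub_mollify_le {ψ : V → ℝ} (hφ : Continuous φ) (hψ : Continuous ψ) {p p' : V}
    {c : ℝ} (h : ∀ q, ‖q‖ ≤ η.rOut → |φ (p - q) - ψ (p' - q)| ≤ c) :
    |mollify η φ p - mollify η ψ p'| ≤ c := by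
  unfold mollify
  rw [← integral_sub (integrable_bump_mul η (by fun_prop)) (integrable_bump_mul η (by fun_prop))]
  simp_rw [← mul_sub]
  exact abs_integral_bump_mul_le η h

theorem abs_mollify_sub_le (hφ : LipCompact φ A R) (hA : 0 ≤ A) (p : V) :
    |mollify η φ p - φ p| ≤ A * η.rOut := by
  have h1 : φ p = ∫ q, η.normed Measure.addHaar q * φ p ∂Measure.addHaar := by
    rw [integral_mul_const, η.integral_normed, one_mul]
  have hc := hφ.continuous
  unfold mollify
  rw [h1, ← integral_sub (integrable_bump_mul η (by fun_prop))
    (integrable_bump_mul η (by fun_prop))]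
  simp_rw [← mul_sub]
  refine abs_integral_bump_mul_le η fun q hq => ?_
  refine (hφ.lip _ _).trans ?_
  gcongr
  simpa using hq

theorem LipCompact.lipCompact_mollify (hφ : LipCompact φ A R) :
    LipCompact (mollify η φ) A (R + η.rOut) := by
  refine ⟨fun p p' => ?_, fun p hp => ?_⟩
  · refine abs_mollify_sub_mollify_le η hφ.continuous hφ.continuous
      fun q _ => (hφ.lip _ _).trans (by simp)
  · have := abs_integral_bump_mul_le η (F := fun q => φ (p - q)) (c := 0) fun q hq => ?_
    · exact abs_nonpos_iff.mp this
    · have h1 := norm_sub_norm_le p q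
      rw [hφ.zero _ (by linarith)]
      simp

theorem mollify_eq_convolution (φ : V → ℝ) : mollify η φ =
    convolution (η.normed Measure.addHaar) φ (ContinuousLinearMap.lsmul ℝ ℝ) Measure.addHaar := by
  ext p
  rw [convolution_lsmul]
  rfl

theorem contDiff_mollify (hφ : Continuous φ) : ContDiff ℝ ∞ (mollify η φ) := by
  rw [mollify_eq_convolution]
  exact η.hasCompactSupport_normed.contDiff_convolution_left _ η.contDiff_normed
    hφ.locallyIntegrable

/-- The derivative of a mollified Lipschitz function is Lipschitz, with a constant that depends on
the function only through its Lipschitz constant. -/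
theorem exists_norm_fderiv_mollify_sub_le : ∃ B : ℝ, 0 ≤ B ∧ ∀ (φ : V → ℝ) (A R : ℝ),
    LipCompact φ A R → 0 ≤ A → ∀ p p',
      ‖fderiv ℝ (mollify η φ) p - fderiv ℝ (mollify η φ) p'‖ ≤ A * B * ‖p - p'‖ := by
  have hη1 : ContDiff ℝ 1 (η.normed (Measure.addHaar : Measure V)) := η.contDiff_normed
  have hDc : Continuous (fderiv ℝ (η.normed (Measure.addHaar : Measure V))) :=
    hη1.continuous_fderiv one_ne_zero
  have hDs : HasCompactSupport (fderiv ℝ (η.normed (Measure.addHaar : Measure V))) :=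
    η.hasCompactSupport_normed.fderiv ℝ
  have hDi : Integrable (fderiv ℝ (η.normed (Measure.addHaar : Measure V))) Measure.addHaar :=
    hDc.integrable_of_hasCompactSupport hDs
  refine ⟨∫ q, ‖fderiv ℝ (η.normed (Measure.addHaar : Measure V)) q‖ ∂Measure.addHaar,
    integral_nonneg fun _ => norm_nonneg _, fun φ A R hφ hA p p' => ?_⟩
  -- The derivative is put on the bump, so one constant `B` serves all the pulled-back test
  -- functions.
  have hformula : ∀ p, fderiv ℝ (mollify η φ) p =
      ∫ q, φ (p - q) • fderiv ℝ (η.normed (Measure.addHaar : Measure V)) q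
        ∂Measure.addHaar := by
    intro p
    rw [mollify_eq_convolution, (η.hasCompactSupport_normed.hasFDerivAt_convolution_left
      (ContinuousLinearMap.lsmul ℝ ℝ) hη1 hφ.continuous.locallyIntegrable p).fderiv,
      convolution_def]
    congr 1
    ext q
    simp [mul_comm]
  have hint : ∀ p, Integrable (fun q => φ (p - q) •
      fderiv ℝ (η.normed (Measure.addHaar : Measure V)) q) Measure.addHaar := by
    intro p
    have hs : Continuous fun q => φ (p - q) := hφ.continuous.comp (continuous_sub_left p)
    exact (hs.smul hDc).integrable_of_hasCompactSupport hDs.smul_left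
  rw [hformula, hformula, ← integral_sub (hint p) (hint p')]
  refine (norm_integral_le_of_norm_le (hDi.norm.const_mul (A * ‖p - p'‖))
    (Filter.Eventually.of_forall fun q => ?_)).trans (le_of_eq ?_)
  · rw [← sub_smul, norm_smul]
    gcongr
    refine (hφ.lip _ _).trans ?_
    simp
  · rw [integral_const_mul]
    ring

end Mollify

end Transport

/-! ### Time regularity of weak solutions. -/

section Transport

variable {V : Type*} [NormedAddCommGroup V]

/-- A velocity field on `t ≥ 0`, Lipschitz in time and space and of linear growth. -/
structure VelocityBounds (b : ℝ → V → V) (Λ : ℝ) : Prop where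
  nonneg : 0 ≤ Λ
  space : ∀ t, 0 ≤ t → ∀ p q, ‖b t p - b t q‖ ≤ Λ * ‖p - q‖
  time : ∀ s t, 0 ≤ s → 0 ≤ t → ∀ p, ‖b s p - b t p‖ ≤ Λ * |s - t|
  growth : ∀ t, 0 ≤ t → ∀ p, ‖b t p‖ ≤ Λ * (1 + ‖p‖)

theorem VelocityBounds.continuous {b : ℝ → V → V} {Λ : ℝ} (hb : VelocityBounds b Λ) {t : ℝ}
    (ht : 0 ≤ t) : Continuous (b t) :=
  (LipschitzWith.of_dist_le' (K := Λ) fun x y => by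
    rw [dist_eq_norm, dist_eq_norm]; exact hb.space t ht x y).continuous

variable [NormedSpace ℝ V] [MeasurableSpace V] [BorelSpace V]

/-- A weakly continuous curve of probability measures solving `∂_t f + div (b f) = 0` weakly. -/
structure IsWeakTransport (b : ℝ → V → V) (f : ℝ → ProbabilityMeasure V) : Prop where
  cont : ContinuousOn f (Set.Ici 0)
  weak : ∀ φ : V → ℝ, ContDiff ℝ ∞ φ → HasCompactSupport φ → ∀ t : ℝ, 0 ≤ t →
    (∫ p, φ p ∂(f t : Measure V)) - ∫ p, φ p ∂(f 0 : Measure V) =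
      ∫ s in (0 : ℝ)..t, ∫ p, fderiv ℝ φ p (b s p) ∂(f s : Measure V)

theorem abs_integral_probability_le {ν : ProbabilityMeasure V} {F : V → ℝ} {c : ℝ}
    (h : ∀ p, |F p| ≤ c) : |∫ p, F p ∂(ν : Measure V)| ≤ c := by
  simpa using norm_integral_le_of_norm_le_const (μ := (ν : Measure V)) (f := F) (C := c)
    (Filter.Eventually.of_forall h)

variable [FiniteDimensional ℝ V] {b : ℝ → V → V} {Λ : ℝ} {f : ℝ → ProbabilityMeasure V}

theorem continuousOn_integral {g : V → ℝ} (hf : ContinuousOn f (Set.Ici 0)) (hg : Continuous g)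
    (hgs : HasCompactSupport g) :
    ContinuousOn (fun t => ∫ p, g p ∂(f t : Measure V)) (Set.Ici 0) := by
  obtain ⟨C, hC⟩ := hgs.exists_bound_of_continuous hg
  intro t ht
  exact ((ProbabilityMeasure.tendsto_iff_forall_integral_tendsto.mp (hf t ht).tendsto)
    (BoundedContinuousFunction.ofNormedAddCommGroup g hg C hC) :)

theorem continuous_fderiv_apply {φ : V → ℝ} (hφ : ContDiff ℝ ∞ φ) (hb : VelocityBounds b Λ)
    {t : ℝ} (ht : 0 ≤ t) : Continuous fun p => fderiv ℝ φ p (b t p) :=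
  (hφ.continuous_fderiv (by simp)).clm_apply (hb.continuous ht)

theorem LipCompact.abs_fderiv_apply_le {φ : V → ℝ} {A R : ℝ} (hφ : LipCompact φ A R) (hA : 0 ≤ A)
    (hR : 0 ≤ R) (hb : VelocityBounds b Λ) {t : ℝ} (ht : 0 ≤ t) (p : V) :
    |fderiv ℝ φ p (b t p)| ≤ A * (Λ * (1 + R)) := by
  have hΛ := hb.nonneg
  by_cases hp : R < ‖p‖
  · rw [hφ.fderiv_zero hp]
    simp only [zero_apply, abs_zero]
    positivity
  · push Not at hp
    refine ((fderiv ℝ φ p).le_opNorm _).trans ?_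
    gcongr
    · exact hφ.norm_fderiv_le hA p
    · exact (hb.growth t ht p).trans (by gcongr)

theorem LipCompact.abs_fderiv_apply_sub_le {φ : V → ℝ} {A R : ℝ} (hφ : LipCompact φ A R)
    (hA : 0 ≤ A) (hb : VelocityBounds b Λ) {s t : ℝ} (hs : 0 ≤ s) (ht : 0 ≤ t)
    (p : V) :
    |fderiv ℝ φ p (b s p) - fderiv ℝ φ p (b t p)| ≤ A * (Λ * |s - t|) := by
  rw [← map_sub]
  refine ((fderiv ℝ φ p).le_opNorm _).trans ?_
  gcongr
  · exact hφ.norm_fderiv_le hA p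
  · exact hb.time s t hs ht p

theorem LipCompact.hasCompactSupport_fderiv_apply {φ : V → ℝ} {A R : ℝ} (hφ : LipCompact φ A R)
    (t : ℝ) : HasCompactSupport fun p => fderiv ℝ φ p (b t p) := by
  have := FiniteDimensional.proper_real V
  refine HasCompactSupport.intro (isCompact_closedBall (0 : V) R) fun p hp => ?_
  rw [hφ.fderiv_zero (by simpa using hp)]
  simp

theorem LipCompact.abs_integral_fderiv_sub_le {φ : V → ℝ} {A R : ℝ} (hφ : LipCompact φ A R)
    (hφs : ContDiff ℝ ∞ φ) (hA : 0 ≤ A) (hb : VelocityBounds b Λ) {s t : ℝ}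
    (hs : 0 ≤ s) (ht : 0 ≤ t) (ν : ProbabilityMeasure V) :
    |(∫ p, fderiv ℝ φ p (b s p) ∂(ν : Measure V)) - ∫ p, fderiv ℝ φ p (b t p) ∂(ν : Measure V)| ≤
      A * (Λ * |s - t|) := by
  rw [← integral_sub]
  · exact abs_integral_probability_le fun p => hφ.abs_fderiv_apply_sub_le hA hb hs ht p
  · exact (continuous_fderiv_apply hφs hb hs).integrable_of_hasCompactSupport
      (hφ.hasCompactSupport_fderiv_apply s)
  · exact (continuous_fderiv_apply hφs hb ht).integrable_of_hasCompactSupport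
      (hφ.hasCompactSupport_fderiv_apply t)

/-- Field and measure both vary. The change of field is small uniformly over probability measures;
with the field frozen, weak continuity of `f` suffices. -/
theorem LipCompact.continuousOn_integral_fderiv {φ : V → ℝ} {A R : ℝ} (hφ : LipCompact φ A R)
    (hφs : ContDiff ℝ ∞ φ) (hA : 0 ≤ A) (hb : VelocityBounds b Λ)
    (hf : IsWeakTransport b f) :
    ContinuousOn (fun s => ∫ p, fderiv ℝ φ p (b s p) ∂(f s : Measure V)) (Set.Ici 0) := by
  intro t ht
  have h1 : Filter.Tendsto (fun s => ∫ p, fderiv ℝ φ p (b t p) ∂(f s : Measure V))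
      (nhdsWithin t (Set.Ici 0)) (nhds (∫ p, fderiv ℝ φ p (b t p) ∂(f t : Measure V))) :=
    continuousOn_integral hf.cont (continuous_fderiv_apply hφs hb ht)
      (hφ.hasCompactSupport_fderiv_apply t) t ht
  have h2 : Filter.Tendsto (fun s => A * (Λ * |s - t|)) (nhdsWithin t (Set.Ici 0)) (nhds 0) := by
    have : Continuous fun s : ℝ => A * (Λ * |s - t|) := by fun_prop
    simpa using (this.tendsto t).mono_left nhdsWithin_le_nhds
  have h3 : Filter.Tendsto (fun s => (∫ p, fderiv ℝ φ p (b s p) ∂(f s : Measure V)) -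
      ∫ p, fderiv ℝ φ p (b t p) ∂(f s : Measure V)) (nhdsWithin t (Set.Ici 0)) (nhds 0) := by
    refine squeeze_zero_norm' ?_ h2
    filter_upwards [self_mem_nhdsWithin] with s hs
    exact hφ.abs_integral_fderiv_sub_le hφs hA hb hs ht (f s)
  have := h3.add h1
  simpa [ContinuousWithinAt] using this

theorem LipCompact.intervalIntegrable {φ : V → ℝ} {A R : ℝ} (hφ : LipCompact φ A R)
    (hφs : ContDiff ℝ ∞ φ) (hA : 0 ≤ A) (hb : VelocityBounds b Λ)
    (hf : IsWeakTransport b f) {s t : ℝ} (hs : 0 ≤ s) (ht : 0 ≤ t) :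
    IntervalIntegrable (fun s => ∫ p, fderiv ℝ φ p (b s p) ∂(f s : Measure V)) volume s t :=
  ((hφ.continuousOn_integral_fderiv hφs hA hb hf).mono fun _ hr =>
    (le_min hs ht).trans hr.1).intervalIntegrable

theorem LipCompact.integral_sub_eq {φ : V → ℝ} {A R : ℝ} (hφ : LipCompact φ A R)
    (hφs : ContDiff ℝ ∞ φ) (hA : 0 ≤ A) (hb : VelocityBounds b Λ)
    (hf : IsWeakTransport b f) {s t : ℝ} (hs : 0 ≤ s) (ht : 0 ≤ t) :
    (∫ p, φ p ∂(f t : Measure V)) - ∫ p, φ p ∂(f s : Measure V) =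
      ∫ r in s..t, ∫ p, fderiv ℝ φ p (b r p) ∂(f r : Measure V) := by
  have h1 := hf.weak φ hφs hφ.hasCompactSupport s hs
  have h2 := hf.weak φ hφs hφ.hasCompactSupport t ht
  rw [← intervalIntegral.integral_interval_sub_left
    (hφ.intervalIntegrable hφs hA hb hf le_rfl ht) (hφ.intervalIntegrable hφs hA hb hf le_rfl hs)]
  linarith

theorem LipCompact.abs_integral_sub_le_of_contDiff {φ : V → ℝ} {A R : ℝ} (hφ : LipCompact φ A R)
    (hφs : ContDiff ℝ ∞ φ) (hA : 0 ≤ A) (hR : 0 ≤ R) (hb : VelocityBounds b Λ)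
    (hf : IsWeakTransport b f) {s t : ℝ} (hs : 0 ≤ s) (hst : s ≤ t) :
    |(∫ p, φ p ∂(f t : Measure V)) - ∫ p, φ p ∂(f s : Measure V)| ≤
      A * (Λ * (1 + R)) * (t - s) := by
  rw [hφ.integral_sub_eq hφs hA hb hf hs (hs.trans hst), ← Real.norm_eq_abs,
    ← abs_of_nonneg (sub_nonneg.mpr hst)]
  refine intervalIntegral.norm_integral_le_of_norm_le_const fun r hr => ?_
  rw [Set.uIoc_of_le hst] at hr
  exact abs_integral_probability_le fun p =>
    hφ.abs_fderiv_apply_le hA hR hb (hs.trans hr.1.le) p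

theorem exists_bump (δ : ℝ) (hδ : 0 < δ) : ∃ η : ContDiffBump (0 : V), η.rOut = δ :=
  ⟨⟨δ / 2, δ, by positivity, by linarith⟩, rfl⟩

theorem LipCompact.abs_integral_mollify_sub_le {φ : V → ℝ} {A R : ℝ} (hφ : LipCompact φ A R)
    (hA : 0 ≤ A) (η : ContDiffBump (0 : V)) (ν : ProbabilityMeasure V) :
    |(∫ p, mollify η φ p ∂(ν : Measure V)) - ∫ p, φ p ∂(ν : Measure V)| ≤ A * η.rOut := by
  rw [← integral_sub ((hφ.lipCompact_mollify η).integrable _) (hφ.integrable _)]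
  exact abs_integral_probability_le fun p => abs_mollify_sub_le η hφ hA p

/-- A weak solution is Lipschitz in time against compactly supported Lipschitz functions. -/
theorem LipCompact.abs_integral_sub_le {φ : V → ℝ} {A R : ℝ} (hφ : LipCompact φ A R)
    (hA : 0 ≤ A) (hR : 0 ≤ R) (hb : VelocityBounds b Λ)
    (hf : IsWeakTransport b f) {s t : ℝ} (hs : 0 ≤ s) (hst : s ≤ t) :
    |(∫ p, φ p ∂(f t : Measure V)) - ∫ p, φ p ∂(f s : Measure V)| ≤
      A * (Λ * (2 + R)) * (t - s) := by
  have hΛ := hb.nonneg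
  have hts := sub_nonneg.mpr hst
  refine le_of_forall_pos_le_add fun κ hκ => ?_
  -- The radius is at most `1`, so mollification enlarges the support by at most `1`; this turns `1
  -- + R` into `2 + R`.
  obtain ⟨η, hη⟩ := exists_bump (V := V) (min 1 (κ / (2 * (A + 1)))) (by positivity)
  have hη1 : η.rOut ≤ 1 := hη ▸ min_le_left _ _
  have hη2 : A * η.rOut ≤ κ / 2 := by
    have : η.rOut ≤ κ / (2 * (A + 1)) := hη ▸ min_le_right _ _
    calc A * η.rOut ≤ (A + 1) * (κ / (2 * (A + 1))) := by
          gcongr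
          · exact η.rOut_pos.le
          · linarith
      _ = κ / 2 := by field_simp
  have h1 := (hφ.lipCompact_mollify η).abs_integral_sub_le_of_contDiff (contDiff_mollify η hφ.continuous) hA
    (add_nonneg hR η.rOut_pos.le) hb hf hs hst
  have h2 := abs_sub_le_iff.mp (hφ.abs_integral_mollify_sub_le hA η (f t))
  have h3 := abs_sub_le_iff.mp (hφ.abs_integral_mollify_sub_le hA η (f s))
  have h4 : A * (Λ * (1 + (R + η.rOut))) * (t - s) ≤ A * (Λ * (2 + R)) * (t - s) := by
    gcongr ?_ * (?_ * ?_) * _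
    linarith
  rw [abs_le] at h1 ⊢
  constructor <;> linarith

/-- First-order expansion in time of a weak solution against a smooth function. -/
theorem LipCompact.abs_integral_sub_sub_le {φ : V → ℝ} {A B R : ℝ} (hφ : LipCompact φ A R)
    (hφs : ContDiff ℝ ∞ φ) (hA : 0 ≤ A) (hB : 0 ≤ B) (hR : 0 ≤ R)
    (hD : ∀ p q, ‖fderiv ℝ φ p - fderiv ℝ φ q‖ ≤ B * ‖p - q‖) (hb : VelocityBounds b Λ)
    (hf : IsWeakTransport b f) {t h : ℝ} (ht : 0 ≤ t) (hh : 0 ≤ h) :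
    |(∫ p, φ p ∂(f (t + h) : Measure V)) - (∫ p, φ p ∂(f t : Measure V)) -
      h * ∫ p, fderiv ℝ φ p (b t p) ∂(f t : Measure V)| ≤
      (A * Λ + (A * Λ + B * (Λ * (1 + R))) * (Λ * (2 + R))) * h ^ 2 := by
  have hΛ := hb.nonneg
  set G := A * Λ + B * (Λ * (1 + R)) with hG
  have hG0 : 0 ≤ G := by positivity
  have hlip : ∀ p q, ‖q‖ ≤ R →
      |fderiv ℝ φ p (b t p) - fderiv ℝ φ q (b t q)| ≤ G * ‖p - q‖ := by
    intro p q hq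
    rw [show fderiv ℝ φ p (b t p) - fderiv ℝ φ q (b t q) =
      fderiv ℝ φ p (b t p - b t q) + (fderiv ℝ φ p - fderiv ℝ φ q) (b t q) by simp]
    have h1 : |fderiv ℝ φ p (b t p - b t q)| ≤ A * (Λ * ‖p - q‖) := by
      refine ((fderiv ℝ φ p).le_opNorm _).trans ?_
      gcongr
      · exact hφ.norm_fderiv_le hA p
      · exact hb.space t ht p q
    have h2 : |(fderiv ℝ φ p - fderiv ℝ φ q) (b t q)| ≤ B * ‖p - q‖ * (Λ * (1 + R)) := by
      refine ((fderiv ℝ φ p - fderiv ℝ φ q).le_opNorm _).trans ?_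
      gcongr
      · exact hD p q
      · exact (hb.growth t ht q).trans (by gcongr)
    refine (abs_add_le _ _).trans ((add_le_add h1 h2).trans (le_of_eq ?_))
    rw [hG]; ring
  -- The integrand is itself Lipschitz with compact support, so its integral varies by `O(h)` along
  -- the solution, which gives the `h²` remainder.
  have hg : LipCompact (fun p => fderiv ℝ φ p (b t p)) G R := by
    refine ⟨fun p q => ?_, fun p hp => by rw [hφ.fderiv_zero hp]; simp⟩
    by_cases hq : ‖q‖ ≤ R
    · exact hlip p q hq
    by_cases hp : ‖p‖ ≤ R
    · rw [abs_sub_comm, norm_sub_rev]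
      exact hlip q p hp
    · rw [hφ.fderiv_zero (not_le.mp hp), hφ.fderiv_zero (not_le.mp hq)]
      simp only [zero_apply, sub_self, abs_zero]
      positivity
  rw [hφ.integral_sub_eq hφs hA hb hf ht (by positivity)]
  have hconst : h * ∫ p, fderiv ℝ φ p (b t p) ∂(f t : Measure V) =
      ∫ _ in t..(t + h), ∫ p, fderiv ℝ φ p (b t p) ∂(f t : Measure V) := by simp
  rw [hconst, ← intervalIntegral.integral_sub
    (hφ.intervalIntegrable hφs hA hb hf ht (by positivity)) (by simp)]
  have hbd : ∀ r ∈ Set.uIoc t (t + h), ‖(∫ p, fderiv ℝ φ p (b r p) ∂(f r : Measure V)) -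
      ∫ p, fderiv ℝ φ p (b t p) ∂(f t : Measure V)‖ ≤
      (A * Λ + G * (Λ * (2 + R))) * h := by
    intro r hr
    rw [Set.uIoc_of_le (by linarith)] at hr
    have h1 := hφ.abs_integral_fderiv_sub_le hφs hA hb (ht.trans hr.1.le) ht (f r)
    have h2 := hg.abs_integral_sub_le hG0 hR hb hf ht hr.1.le
    rw [abs_of_nonneg (sub_nonneg.mpr hr.1.le)] at h1
    have h3 : r - t ≤ h := by linarith [hr.2]
    have h4 : A * (Λ * (r - t)) ≤ A * (Λ * h) := by gcongr
    have h5 : G * (Λ * (2 + R)) * (r - t) ≤ G * (Λ * (2 + R)) * h := by gcongr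
    refine (norm_sub_le_norm_sub_add_norm_sub _
      (∫ p, fderiv ℝ φ p (b t p) ∂(f r : Measure V)) _).trans ?_
    rw [Real.norm_eq_abs, Real.norm_eq_abs]
    linarith
  refine (intervalIntegral.norm_integral_le_of_norm_le_const hbd).trans (le_of_eq ?_)
  rw [add_sub_cancel_left, abs_of_nonneg hh]
  ring

/-- A function with `B`-Lipschitz derivative agrees with its first-order expansion up to
`B ‖u‖²`. -/
theorem abs_sub_sub_fderiv_le {φ : V → ℝ} {B : ℝ} (hφ : Differentiable ℝ φ) (hB : 0 ≤ B)
    (hD : ∀ p q, ‖fderiv ℝ φ p - fderiv ℝ φ q‖ ≤ B * ‖p - q‖) (p u : V) :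
    |φ (p + u) - φ p - fderiv ℝ φ p u| ≤ B * ‖u‖ ^ 2 := by
  have := (convex_closedBall p ‖u‖).norm_image_sub_le_of_norm_fderiv_le' (𝕜 := ℝ) (f := φ)
    (φ := fderiv ℝ φ p) (C := B * ‖u‖) (x := p) (y := p + u) (fun x _ => hφ x)
    (fun x hx => (hD x p).trans (by gcongr; simpa [dist_eq_norm] using hx))
    (by simp) (by simp)
  simpa [sq, mul_assoc] using this

end Transport

/-! ### Convergence of consistent schemes by duality. -/

section Convergence

variable {V : Type*} [NormedAddCommGroup V] [NormedSpace ℝ V]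

/-- `S` approximates the flow of `b` from time `t` to time `t + h` to second order in `h`. -/
structure IsConsistentStep (b : ℝ → V → V) (c t h : ℝ) (S : V → V) : Prop where
  lip : ∀ p q, ‖S p - S q‖ ≤ (1 + c * h) * ‖p - q‖
  move : ∀ p, ‖S p - p‖ ≤ c * h * (1 + ‖p‖)
  consistent : ∀ p, ‖S p - p - h • b t p‖ ≤ c * h ^ 2 * (1 + ‖p‖)

variable {b : ℝ → V → V} {Λ : ℝ}

/-- A step moves points by at most `c h (1 + ‖p‖)`, so it cannot bring far points into the support.
The condition `c h ≤ 1/2` is what makes `(1 - c h)(1 + 2 c h) ≥ 1`. -/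
theorem LipCompact.comp_step {φ : V → ℝ} {a r c t h : ℝ} (hφ : LipCompact φ a r) (ha : 0 ≤ a)
    (hr : 0 ≤ r) (hc : 0 ≤ c) (hh : 0 ≤ h) (hch : c * h ≤ 1 / 2) {S : V → V}
    (hS : IsConsistentStep b c t h S) :
    LipCompact (fun p => φ (S p)) (a * Real.exp (c * h)) ((1 + r) * Real.exp (2 * c * h) - 1) := by
  have hch0 : 0 ≤ c * h := by positivity
  refine ⟨fun p q => ?_, fun p hp => hφ.zero _ ?_⟩
  · refine (hφ.lip _ _).trans ?_
    rw [mul_assoc]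
    gcongr
    refine (hS.lip p q).trans ?_
    gcongr
    linarith [Real.add_one_le_exp (c * h)]
  · have h1 : (1 + r) * (1 + 2 * c * h) ≤ (1 + r) * Real.exp (2 * c * h) := by
      gcongr
      linarith [Real.add_one_le_exp (2 * c * h)]
    have h2 : ‖p‖ ≤ ‖S p‖ + c * h * (1 + ‖p‖) := by
      have := norm_sub_norm_le p (S p)
      rw [norm_sub_rev] at this
      linarith [hS.move p]
    have h3 : (1 + r) * (1 + 2 * c * h) < 1 + ‖p‖ := by linarith
    have h4 : (1 - c * h) * ((1 + r) * (1 + 2 * c * h)) < (1 - c * h) * (1 + ‖p‖) := by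
      gcongr
      linarith
    have h5 : 1 + r ≤ (1 - c * h) * ((1 + r) * (1 + 2 * c * h)) := by
      have : 0 ≤ (1 + r) * (c * h * (1 - 2 * (c * h))) := by
        have : 0 ≤ 1 - 2 * (c * h) := by linarith
        positivity
      linear_combination this
    linarith

variable [FiniteDimensional ℝ V] [MeasurableSpace V] [BorelSpace V]
  {f : ℝ → ProbabilityMeasure V}

/-- One step of the duality argument: transporting a mollified test function back by `S`. -/
theorem exists_step_bound {A R c : ℝ} (hA : 0 ≤ A) (hR : 0 ≤ R) (hc : 0 ≤ c)
    (hb : VelocityBounds b Λ) (hf : IsWeakTransport b f) (η : ContDiffBump (0 : V))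
    (hη : η.rOut ≤ 1) :
    ∃ D, 0 ≤ D ∧ ∀ (φ : V → ℝ) (S : V → V) (t h : ℝ), LipCompact φ A R →
      LipCompact (fun p => φ (S p)) A R → 0 ≤ t → 0 ≤ h → IsConsistentStep b c t h S →
      |(∫ p, mollify η φ p ∂(f (t + h) : Measure V)) -
        ∫ p, mollify η (fun p => φ (S p)) p ∂(f t : Measure V)| ≤
        A * Λ * η.rOut * h + D * h ^ 2 := by
  obtain ⟨B, hB0, hB⟩ := exists_norm_fderiv_mollify_sub_le η
  have hΛ := hb.nonneg
  set ρ := R + 1 with hρ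
  have hρ0 : 0 ≤ ρ := by positivity
  set D₁ := A * Λ + (A * Λ + A * B * (Λ * (1 + ρ))) * (Λ * (2 + ρ)) with hD₁
  refine ⟨D₁ + (A * c * (2 + ρ) + A * B * (Λ * (1 + ρ)) ^ 2), by positivity, ?_⟩
  intro φ S t h hφ hφS ht hh hS
  have hψ := (hφ.lipCompact_mollify η).mono le_rfl (by linarith : R + η.rOut ≤ ρ)
  have hψS := (hφS.lipCompact_mollify η).mono le_rfl (by linarith : R + η.rOut ≤ ρ)
  have hψs := contDiff_mollify η hφ.continuous
  have hD := hB φ A R hφ hA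
  have htime := hψ.abs_integral_sub_sub_le hψs hA (by positivity) hρ0 hD hb hf ht hh
  have hpoint : ∀ p, |mollify η (fun p => φ (S p)) p - mollify η φ p -
      h * fderiv ℝ (mollify η φ) p (b t p)| ≤
      A * (c * h ^ 2 * (2 + ρ) + h * (Λ * η.rOut)) + A * B * (h * (Λ * (1 + ρ))) ^ 2 := by
    intro p
    have hη0 := η.rOut_pos.le
    by_cases hp : ρ < ‖p‖
    · rw [hψ.zero p hp, hψS.zero p hp, hψ.fderiv_zero hp]
      simp only [zero_apply, mul_zero, sub_self, abs_zero]
      positivity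
    push Not at hp
    -- This is the commutator: `φ (S (p - q))` against `φ (p + h b(p) - q)`. Consistency costs `h²`,
    -- and evaluating `b` at `p - q` instead of `p` costs `h Λ ‖q‖` with `‖q‖ ≤ η.rOut`.
    have h1 : |mollify η (fun p => φ (S p)) p - mollify η φ (p + h • b t p)| ≤
        A * (c * h ^ 2 * (2 + ρ) + h * (Λ * η.rOut)) := by
      refine abs_mollify_sub_mollify_le η hφS.continuous hφ.continuous fun q hq => ?_
      refine (hφ.lip _ _).trans ?_
      gcongr
      calc ‖S (p - q) - (p + h • b t p - q)‖
          = ‖(S (p - q) - (p - q) - h • b t (p - q)) + h • (b t (p - q) - b t p)‖ := by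
            congr 1; module
        _ ≤ c * h ^ 2 * (1 + ‖p - q‖) + h * (Λ * ‖(p - q) - p‖) := by
          refine (norm_add_le _ _).trans ?_
          rw [norm_smul, Real.norm_of_nonneg hh]
          gcongr
          · exact hS.consistent _
          · exact hb.space t ht _ _
        _ ≤ _ := by
          rw [sub_sub_cancel_left, norm_neg]
          gcongr ?_ * ?_ + h * (Λ * ?_)
          have := norm_sub_le p q
          linarith
    have h2 := abs_sub_sub_fderiv_le (hψs.differentiable (by simp)) (by positivity) hD p
      (h • b t p)
    have h3 : ‖h • b t p‖ ≤ h * (Λ * (1 + ρ)) := by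
      rw [norm_smul, Real.norm_of_nonneg hh]
      gcongr
      exact (hb.growth t ht p).trans (by gcongr)
    have h4 : A * B * ‖h • b t p‖ ^ 2 ≤ A * B * (h * (Λ * (1 + ρ))) ^ 2 := by gcongr
    rw [map_smul, smul_eq_mul] at h2
    refine le_trans (le_of_eq_of_le ?_ (abs_add_le _ _)) (add_le_add h1 (h2.trans h4))
    congr 1
    ring
  have hspace : |(∫ p, mollify η (fun p => φ (S p)) p ∂(f t : Measure V)) -
      (∫ p, mollify η φ p ∂(f t : Measure V)) -
      h * ∫ p, fderiv ℝ (mollify η φ) p (b t p) ∂(f t : Measure V)| ≤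
      A * (c * h ^ 2 * (2 + ρ) + h * (Λ * η.rOut)) + A * B * (h * (Λ * (1 + ρ))) ^ 2 := by
    have hi := (continuous_fderiv_apply hψs hb ht).integrable_of_hasCompactSupport
      (μ := (f t : Measure V)) (hψ.hasCompactSupport_fderiv_apply t)
    have hd : Integrable (fun p => mollify η (fun p => φ (S p)) p - mollify η φ p)
        (f t : Measure V) := (hψS.integrable _).sub (hψ.integrable _)
    rw [← integral_const_mul, ← integral_sub (hψS.integrable _) (hψ.integrable _),
      ← integral_sub hd (hi.const_mul h)]
    exact abs_integral_probability_le hpoint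
  have := abs_sub_le_iff.mp htime
  have := abs_sub_le_iff.mp hspace
  rw [abs_le]
  constructor <;> linarith

/-- The induction peels off the last step and replaces `φ` by `φ ∘ S N`. The mollification is
applied to the unmollified pullback at each stage, so smoothing never accumulates and a single pair
`A`, `R` bounds all stages. -/
theorem abs_integral_mollify_iterate_le {A R c h D δ : ℝ} (hc : 0 ≤ c) (hh : 0 ≤ h)
    (hch : c * h ≤ 1 / 2) (η : ContDiffBump (0 : V))
    (hstep : ∀ (φ : V → ℝ) (S : V → V) (t h : ℝ), LipCompact φ A R →
      LipCompact (fun p => φ (S p)) A R → 0 ≤ t → 0 ≤ h → IsConsistentStep b c t h S →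
      |(∫ p, mollify η φ p ∂(f (t + h) : Measure V)) -
        ∫ p, mollify η (fun p => φ (S p)) p ∂(f t : Measure V)| ≤ δ * h + D * h ^ 2)
    {S : ℕ → V → V} (hS : ∀ k : ℕ, IsConsistentStep b c (k * h) h (S k)) {Φ : ℕ → V → V}
    (hΦ0 : ∀ p, Φ 0 p = p) (hΦ : ∀ n p, Φ (n + 1) p = S n (Φ n p)) (N : ℕ) (φ : V → ℝ) (a r : ℝ)
    (hφ : LipCompact φ a r) (ha : 0 ≤ a) (hr : 0 ≤ r) (haA : a * Real.exp (c * h * N) ≤ A)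
    (hrR : (1 + r) * Real.exp (2 * c * h * N) ≤ 1 + R) :
    LipCompact (fun p => φ (Φ N p)) A R ∧
      |(∫ p, mollify η φ p ∂(f (N * h) : Measure V)) -
        ∫ p, mollify η (fun p => φ (Φ N p)) p ∂(f 0 : Measure V)| ≤
        N * (δ * h + D * h ^ 2) := by
  induction N generalizing φ a r with
  | zero =>
    simp only [hΦ0, Nat.cast_zero, mul_zero, Real.exp_zero, mul_one] at *
    exact ⟨hφ.mono haA (by linarith), by simp⟩
  | succ N ih =>
    have hφ' := hφ.comp_step ha hr hc hh hch (hS N)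
    have hexp1 : 1 ≤ Real.exp (c * h) := Real.one_le_exp (by positivity)
    have hexp2 : 1 ≤ Real.exp (2 * c * h) := Real.one_le_exp (by positivity)
    have hexp3 : 1 ≤ Real.exp (c * h * N) := Real.one_le_exp (by positivity)
    have hexp4 : 1 ≤ Real.exp (2 * c * h * N) := Real.one_le_exp (by positivity)
    have haA' : a * Real.exp (c * h) * Real.exp (c * h * N) ≤ A := by
      refine le_of_eq_of_le ?_ haA
      rw [mul_assoc, ← Real.exp_add]
      push_cast
      ring_nf
    have hrR' : (1 + r) * Real.exp (2 * c * h) * Real.exp (2 * c * h * N) ≤ 1 + R := by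
      refine le_of_eq_of_le ?_ hrR
      rw [mul_assoc, ← Real.exp_add]
      push_cast
      ring_nf
    have ha' : a ≤ a * Real.exp (c * h) := le_mul_of_one_le_right ha hexp1
    have hr' : 1 + r ≤ (1 + r) * Real.exp (2 * c * h) := le_mul_of_one_le_right (by linarith) hexp2
    have haA1 : a * Real.exp (c * h) ≤ A :=
      (le_mul_of_one_le_right (by positivity) hexp3).trans haA'
    have hrR1 : (1 + r) * Real.exp (2 * c * h) ≤ 1 + R :=
      (le_mul_of_one_le_right (by positivity) hexp4).trans hrR'
    obtain ⟨h1, h2⟩ := ih _ _ _ hφ' (by positivity) (by linarith) haA' (by simpa using hrR')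
    simp only [hΦ]
    refine ⟨h1, ?_⟩
    have h3 := hstep φ (S N) (N * h) h (hφ.mono (ha'.trans haA1) (by linarith))
      (hφ'.mono haA1 (by linarith)) (by positivity) hh (hS N)
    rw [show ((N + 1 : ℕ) : ℝ) * h = N * h + h by push_cast; ring]
    refine (abs_sub_le _ _ _).trans ((add_le_add h3 h2).trans (le_of_eq ?_))
    push_cast
    ring

/-- A consistent one-step scheme converges, in duality with compactly supported Lipschitz functions,
to any weak solution of the transport equation. In particular weak solutions are unique. -/
theorem exists_step_size {φ : V → ℝ} {a r c T κ : ℝ} (hφ : LipCompact φ a r) (ha : 0 ≤ a)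
    (hr : 0 ≤ r) (hc : 0 ≤ c) (hT : 0 ≤ T) (hκ : 0 < κ) (hb : VelocityBounds b Λ)
    (hf : IsWeakTransport b f) :
    ∃ h₀, 0 < h₀ ∧ ∀ (h : ℝ) (N : ℕ) (S Φ : ℕ → V → V), 0 < h → h ≤ h₀ → N * h = T →
      (∀ k : ℕ, IsConsistentStep b c (k * h) h (S k)) → (∀ p, Φ 0 p = p) →
      (∀ n p, Φ (n + 1) p = S n (Φ n p)) →
      |(∫ p, φ p ∂(f T : Measure V)) - ∫ p, φ (Φ N p) ∂(f 0 : Measure V)| ≤ κ := by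
  have hΛ := hb.nonneg
  set A := a * Real.exp (c * T) with hA
  set R := (1 + r) * Real.exp (2 * c * T) - 1 with hR
  have hA0 : 0 ≤ A := by positivity
  have hR0 : 0 ≤ R := by
    have : 1 + r ≤ (1 + r) * Real.exp (2 * c * T) :=
      le_mul_of_one_le_right (by linarith) (Real.one_le_exp (by positivity))
    linarith
  have haA : a ≤ A := le_mul_of_one_le_right ha (Real.one_le_exp (by positivity))
  -- All errors linear in the bump radius: one mollification at each end, and the commutators summed
  -- over time `T`.
  set P := 2 * A + T * (A * Λ) with hP
  have hP0 : 0 ≤ P := by positivity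
  obtain ⟨η, hη⟩ := exists_bump (V := V) (min 1 (κ / (2 * (P + 1)))) (by positivity)
  have hη1 : η.rOut ≤ 1 := hη ▸ min_le_left _ _
  have hη2 : P * η.rOut ≤ κ / 2 := by
    have : η.rOut ≤ κ / (2 * (P + 1)) := hη ▸ min_le_right _ _
    calc P * η.rOut ≤ (P + 1) * (κ / (2 * (P + 1))) := by
          gcongr
          · exact η.rOut_pos.le
          · linarith
      _ = κ / 2 := by field_simp
  obtain ⟨D, hD0, hD⟩ := exists_step_bound hA0 hR0 hc hb hf η hη1
  -- The step size is chosen after the bump, since `D` depends on `η`.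
  refine ⟨min (1 / (2 * (c + 1))) (κ / (2 * (T * D + 1))), by positivity, ?_⟩
  intro h N S Φ hh hh₀ hNh hS hΦ0 hΦ
  have hch : c * h ≤ 1 / 2 := by
    calc c * h ≤ (c + 1) * (1 / (2 * (c + 1))) := by
          gcongr
          · linarith
          · exact hh₀.trans (min_le_left _ _)
      _ = 1 / 2 := by field_simp
  have hTD : T * D * h ≤ κ / 2 := by
    calc T * D * h ≤ (T * D + 1) * (κ / (2 * (T * D + 1))) := by
          gcongr
          · linarith
          · exact hh₀.trans (min_le_right _ _)
      _ = κ / 2 := by field_simp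
  obtain ⟨hΦN, hmain⟩ := abs_integral_mollify_iterate_le hc hh.le hch η hD hS hΦ0 hΦ N φ a r hφ ha hr
    (by rw [mul_assoc, mul_comm h, hNh])
    (by rw [mul_assoc, mul_comm h, hNh, hR]; linarith)
  have h1 := hφ.abs_integral_mollify_sub_le ha η (f T)
  have h2 := hΦN.abs_integral_mollify_sub_le hA0 η (f 0)
  have h3 : a * η.rOut ≤ A * η.rOut := mul_le_mul_of_nonneg_right haA η.rOut_pos.le
  have h4 : N * (A * Λ * η.rOut * h + D * h ^ 2) = T * (A * Λ) * η.rOut + T * D * h := by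
    rw [← hNh]; ring
  rw [hNh, h4] at hmain
  have h5 : P * η.rOut = 2 * (A * η.rOut) + T * (A * Λ) * η.rOut := by rw [hP]; ring
  rw [abs_le] at *
  constructor <;> linarith [h1.1, h1.2, h2.1, h2.2, hmain.1, hmain.2]

end Convergence

/-! ### Cutoffs and passage to bounded test functions. -/

section Cutoff

variable {V : Type*} [NormedAddCommGroup V]

/-- A Lipschitz cutoff equal to `1` on the ball of radius `ρ` and to `0` outside the ball of radius
`ρ + 1`. -/
noncomputable def cutoff (ρ : ℝ) (p : V) : ℝ := max 0 (min 1 (ρ + 1 - ‖p‖))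

theorem cutoff_nonneg (ρ : ℝ) (p : V) : 0 ≤ cutoff ρ p := le_max_left _ _

theorem cutoff_le_one (ρ : ℝ) (p : V) : cutoff ρ p ≤ 1 :=
  max_le zero_le_one (min_le_left _ _)

theorem lipCompact_cutoff (ρ : ℝ) : LipCompact (cutoff ρ : V → ℝ) 1 (ρ + 1) := by
  refine ⟨fun p q => ?_, fun p hp => ?_⟩
  · have h1 := abs_max_sub_max_le_max 0 (min 1 (ρ + 1 - ‖p‖)) 0 (min 1 (ρ + 1 - ‖q‖))
    have h2 := abs_min_sub_min_le_max 1 (ρ + 1 - ‖p‖) 1 (ρ + 1 - ‖q‖)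
    have h3 : |(ρ + 1 - ‖p‖) - (ρ + 1 - ‖q‖)| ≤ ‖p - q‖ := by
      rw [sub_sub_sub_cancel_left, abs_sub_comm]
      exact abs_norm_sub_norm_le p q
    simp only [sub_self, abs_zero, abs_nonneg, max_eq_right] at h1 h2
    rw [one_mul]
    exact h1.trans (h2.trans h3)
  · exact max_eq_left ((min_le_right _ _).trans (by linarith))

theorem lipCompact_cutoff_mul {φ : V → ℝ} {a B : ℝ} (hφ : ∀ x y, |φ x - φ y| ≤ a * ‖x - y‖)
    (hB : ∀ x, |φ x| ≤ B) (ρ : ℝ) : LipCompact (fun p => cutoff ρ p * φ p) (a + B) (ρ + 1) := by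
  refine ⟨fun p q => ?_, fun p hp => by simp [(lipCompact_cutoff ρ).zero p hp]⟩
  rw [show cutoff ρ p * φ p - cutoff ρ q * φ q =
    cutoff ρ p * (φ p - φ q) + (cutoff ρ p - cutoff ρ q) * φ q by ring]
  have hB0 : 0 ≤ B := (abs_nonneg _).trans (hB q)
  calc _ ≤ 1 * (a * ‖p - q‖) + 1 * ‖p - q‖ * B := by
        refine (abs_add_le _ _).trans ?_
        rw [abs_mul, abs_mul, abs_of_nonneg (cutoff_nonneg ρ p)]
        gcongr
        · exact cutoff_le_one ρ p
        · exact hφ p q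
        · exact (lipCompact_cutoff ρ).lip p q
        · exact hB q
    _ = _ := by ring

variable [MeasurableSpace V] [BorelSpace V]

theorem exists_integral_cutoff_ge (ν : ProbabilityMeasure V) {κ : ℝ} (hκ : 0 < κ) :
    ∃ ρ : ℝ, 0 ≤ ρ ∧ 1 - κ ≤ ∫ p, cutoff ρ p ∂(ν : Measure V) := by
  have hlim : Filter.Tendsto (fun n : ℕ => ∫ p, cutoff (n : ℝ) p ∂(ν : Measure V)) Filter.atTop
      (nhds (∫ _, (1 : ℝ) ∂(ν : Measure V))) := by
    refine tendsto_integral_of_dominated_convergence (fun _ => 1)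
      (fun n => ?_) (integrable_const 1)
      (fun n => Filter.Eventually.of_forall fun p => ?_)
      (Filter.Eventually.of_forall fun p => ?_)
    · exact (lipCompact_cutoff (V := V) n).continuous.measurable.aestronglyMeasurable
    · rw [Real.norm_of_nonneg (cutoff_nonneg _ _)]
      exact cutoff_le_one _ _
    · obtain ⟨m, hm⟩ := exists_nat_ge ‖p‖
      refine tendsto_const_nhds.congr' ?_
      filter_upwards [Filter.eventually_ge_atTop m] with n hn
      have : (m : ℝ) ≤ n := by exact_mod_cast hn
      rw [cutoff, min_eq_left (by linarith), max_eq_right zero_le_one]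
  rw [integral_const, probReal_univ, one_smul] at hlim
  obtain ⟨n, hn⟩ := (hlim.eventually_const_le (show 1 - κ < 1 by linarith)).exists
  exact ⟨n, by positivity, hn⟩

end Cutoff

section Convergence

variable {V : Type*} [NormedAddCommGroup V] [NormedSpace ℝ V] [FiniteDimensional ℝ V]
  [MeasurableSpace V] [BorelSpace V] {b : ℝ → V → V} {Λ : ℝ} {f : ℝ → ProbabilityMeasure V}

theorem IsConsistentStep.continuous {c t h : ℝ} {S : V → V} (hS : IsConsistentStep b c t h S) :
    Continuous S :=
  (LipschitzWith.of_dist_le' (K := 1 + c * h) fun x y => by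
    rw [dist_eq_norm, dist_eq_norm]; exact hS.lip x y).continuous

/-- A consistent one-step scheme converges, in duality with bounded Lipschitz functions, to any weak
solution of the transport equation. -/
theorem exists_step_size_of_bounded {φ : V → ℝ} {a B c T κ : ℝ}
    (hφ : ∀ x y, |φ x - φ y| ≤ a * ‖x - y‖) (hB : ∀ x, |φ x| ≤ B) (ha : 0 ≤ a)
    (hc : 0 ≤ c) (hT : 0 ≤ T) (hκ : 0 < κ) (hb : VelocityBounds b Λ)
    (hf : IsWeakTransport b f) :
    ∃ h₀, 0 < h₀ ∧ ∀ (h : ℝ) (N : ℕ) (S Φ : ℕ → V → V), 0 < h → h ≤ h₀ → N * h = T →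
      (∀ k : ℕ, IsConsistentStep b c (k * h) h (S k)) → (∀ p, Φ 0 p = p) →
      (∀ n p, Φ (n + 1) p = S n (Φ n p)) →
      |(∫ p, φ p ∂(f T : Measure V)) - ∫ p, φ (Φ N p) ∂(f 0 : Measure V)| ≤ κ := by
  have hB0 : 0 ≤ B := (abs_nonneg _).trans (hB 0)
  -- The error budget is `B τ` for the mass of `f T` cut off, `2 B τ` for that of the discrete
  -- push-forward, and `τ` for the truncated test function.
  set τ := κ / (3 * B + 1) with hτ
  have hτ0 : 0 < τ := by positivity
  obtain ⟨ρ, hρ0, hρ⟩ := exists_integral_cutoff_ge (f T) hτ0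
  have hcut := lipCompact_cutoff (V := V) ρ
  have hmul := lipCompact_cutoff_mul hφ hB ρ
  obtain ⟨h₁, hh₁, H₁⟩ := exists_step_size hcut zero_le_one (by linarith) hc hT hτ0 hb hf
  obtain ⟨h₂, hh₂, H₂⟩ := exists_step_size hmul (by linarith) (by linarith) hc hT hτ0 hb hf
  refine ⟨min h₁ h₂, lt_min hh₁ hh₂, fun h N S Φ hh hhle hN hS hΦ0 hΦ => ?_⟩
  have G₁ := H₁ h N S Φ hh (hhle.trans (min_le_left _ _)) hN hS hΦ0 hΦ
  have G₂ := H₂ h N S Φ hh (hhle.trans (min_le_right _ _)) hN hS hΦ0 hΦ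
  have hcont : ∀ n, Continuous (Φ n) := by
    intro n
    induction n with
    | zero => exact continuous_id.congr fun p => (hΦ0 p).symm
    | succ n ih => exact ((hS n).continuous.comp ih).congr fun p => (hΦ n p).symm
  have hφc : Continuous φ := (LipschitzWith.of_dist_le' (K := a) fun x y => by
    rw [Real.dist_eq, dist_eq_norm]; exact hφ x y).continuous
  have hbound : ∀ (ν : ProbabilityMeasure V) (Ψ : V → V), Continuous Ψ →
      |(∫ p, φ (Ψ p) ∂(ν : Measure V)) - ∫ p, cutoff ρ (Ψ p) * φ (Ψ p) ∂(ν : Measure V)| ≤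
        B * (1 - ∫ p, cutoff ρ (Ψ p) ∂(ν : Measure V)) := by
    intro ν Ψ hΨ
    have i1 : Integrable (fun p => φ (Ψ p)) (ν : Measure V) :=
      Integrable.of_bound (hφc.comp hΨ).measurable.aestronglyMeasurable B
        (Filter.Eventually.of_forall fun p => hB _)
    have i2 : Integrable (fun p => cutoff ρ (Ψ p)) (ν : Measure V) :=
      Integrable.of_bound (hcut.continuous.comp hΨ).measurable.aestronglyMeasurable 1
        (Filter.Eventually.of_forall fun p => by
          rw [Real.norm_of_nonneg (cutoff_nonneg _ _)]
          exact cutoff_le_one _ _)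
    have i3 : Integrable (fun p => cutoff ρ (Ψ p) * φ (Ψ p)) (ν : Measure V) :=
      Integrable.of_bound (hmul.continuous.comp hΨ).measurable.aestronglyMeasurable (1 * B)
        (Filter.Eventually.of_forall fun p => by
          rw [norm_mul, Real.norm_of_nonneg (cutoff_nonneg _ _)]
          exact mul_le_mul (cutoff_le_one _ _) (hB _) (abs_nonneg _) zero_le_one)
    rw [← integral_sub i1 i3, show (1 : ℝ) = ∫ _, (1 : ℝ) ∂(ν : Measure V) by simp,
      ← integral_sub (integrable_const _) i2, ← integral_const_mul, ← Real.norm_eq_abs]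
    refine norm_integral_le_of_norm_le (((integrable_const _).sub i2).const_mul B)
      (Filter.Eventually.of_forall fun p => ?_)
    rw [← one_sub_mul, norm_mul, Real.norm_of_nonneg (by linarith [cutoff_le_one ρ (Ψ p)]),
      mul_comm]
    gcongr
    · linarith [cutoff_le_one ρ (Ψ p)]
    · exact hB _
  have b1 := hbound (f T) id continuous_id
  have b2 := hbound (f 0) (Φ N) (hcont N)
  simp only [id] at b1
  have b1' : B * (1 - ∫ p, cutoff ρ p ∂(f T : Measure V)) ≤ B * τ := by
    gcongr
    linarith
  -- Tightness of the push-forward is inherited from `f T`: convergence tested on the cutoff itself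
  -- shows that the two retained masses differ by at most `τ`.
  have b2' : B * (1 - ∫ p, cutoff ρ (Φ N p) ∂(f 0 : Measure V)) ≤ B * (2 * τ) := by
    gcongr
    have := (abs_le.mp G₁).2
    linarith
  have hsum : B * τ + τ + B * (2 * τ) = κ := by rw [hτ]; field_simp; ring
  rw [abs_le] at *
  constructor <;> linarith [b1.1, b1.2, b2.1, b2.2, G₂.1, G₂.2]

end Convergence

/-! ### The Vlasov characteristics as a transport field. -/

/-- The velocity field on phase space of the characteristics of the Vlasov equation. -/
noncomputable def phaseField (ε : ℝ) (E : ℝ → Plane → Plane) (t : ℝ) (p : Phase) : Phase :=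
  ε⁻¹ • (p.2, E t p.1 - ε⁻¹ • perp p.2)

theorem norm_smul_prod_le {c d : ℝ} (hc : 0 ≤ c) {x y : Plane} (hx : ‖x‖ ≤ d) (hy : ‖y‖ ≤ d) :
    ‖c • ((x, y) : Phase)‖ ≤ c * d := by
  rw [norm_smul, Real.norm_of_nonneg hc, Prod.norm_mk]
  gcongr
  exact max_le hx hy

theorem velocityBounds_phaseField {E : ℝ → Plane → Plane} {K L M ε : ℝ} (hb : FieldBounds E K L M)
    (hε : 0 < ε) : VelocityBounds (phaseField ε E) (ε⁻¹ * (1 + K + L + M + ε⁻¹)) := by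
  have hK := hb.K_nonneg; have hL := hb.L_nonneg; have hM := hb.M_nonneg
  have he : 0 ≤ ε⁻¹ := by positivity
  refine ⟨by positivity, fun t ht p q => ?_, fun s t hs ht p => ?_, fun t ht p => ?_⟩
  · have h1 : ‖p.1 - q.1‖ ≤ ‖p - q‖ := norm_fst_le (p - q)
    have h2 : ‖p.2 - q.2‖ ≤ ‖p - q‖ := norm_snd_le (p - q)
    rw [phaseField, phaseField, ← smul_sub, Prod.mk_sub_mk, mul_assoc]
    refine norm_smul_prod_le he ?_ ?_
    · refine h2.trans (le_mul_of_one_le_left (norm_nonneg _) (by linarith))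
    · calc ‖E t p.1 - ε⁻¹ • perp p.2 - (E t q.1 - ε⁻¹ • perp q.2)‖
          = ‖(E t p.1 - E t q.1) - ε⁻¹ • perp (p.2 - q.2)‖ := by
            rw [perp_sub]; congr 1; module
        _ ≤ K * ‖p - q‖ + ε⁻¹ * ‖p - q‖ := by
          refine (norm_sub_le _ _).trans ?_
          rw [norm_smul, norm_perp, Real.norm_of_nonneg he]
          gcongr
          exact (hb.space t ht _ _).trans (by gcongr)
        _ = (K + ε⁻¹) * ‖p - q‖ := by ring
        _ ≤ _ := by gcongr; linarith
  · rw [phaseField, phaseField, ← smul_sub, Prod.mk_sub_mk, mul_assoc]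
    refine norm_smul_prod_le he ?_ ?_
    · rw [sub_self, norm_zero]
      positivity
    · rw [sub_sub_sub_cancel_right]
      refine (hb.time s t hs ht _).trans ?_
      gcongr
      linarith
  · rw [phaseField, mul_assoc]
    have h2 : ‖p.2‖ ≤ ‖p‖ := norm_snd_le p
    have h0 : 0 ≤ ‖p‖ := norm_nonneg p
    refine norm_smul_prod_le he ?_ ?_
    · nlinarith [mul_nonneg (by positivity : 0 ≤ K + L + M + ε⁻¹) (by positivity : 0 ≤ 1 + ‖p‖)]
    · calc ‖E t p.1 - ε⁻¹ • perp p.2‖ ≤ M + ε⁻¹ * ‖p‖ := by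
            refine (norm_sub_le _ _).trans ?_
            rw [norm_smul, norm_perp, Real.norm_of_nonneg he]
            gcongr
            exact hb.size t ht _
        _ ≤ M * (1 + ‖p‖) + ε⁻¹ * (1 + ‖p‖) := by
          gcongr
          · exact le_mul_of_one_le_right hM (by linarith)
          · linarith
        _ = (M + ε⁻¹) * (1 + ‖p‖) := by ring
        _ ≤ _ := by gcongr; linarith

theorem IsVlasovSolution.isWeakTransport {ε : ℝ} (hε : 0 < ε) {E : ℝ → Plane → Plane}
    {f₀ : ProbabilityMeasure Phase} {f : ℝ → ProbabilityMeasure Phase}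
    (hf : IsVlasovSolution ε E f₀ f) : IsWeakTransport (phaseField ε E) f := by
  obtain ⟨h0, hcont, hweak⟩ := hf
  refine ⟨hcont, fun φ hφ hφs t ht => ?_⟩
  have := hweak φ hφ hφs t ht
  simp only [phaseField, map_smul, smul_eq_mul, integral_const_mul,
    intervalIntegral.integral_const_mul]
  rw [← this, h0]
  field_simp

/-! ### Consistency and continuity of the semi-implicit step. -/

section Step

variable {E : ℝ → Plane → Plane} {K L M ε h t : ℝ}

theorem norm_velocityUpdate_le (hb : FieldBounds E K L M) (hε : 0 < ε) (hh : 0 ≤ h) (ht : 0 ≤ t)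
    (p : Phase) : ‖velocityUpdate ε h E t p‖ ≤ ‖p.2‖ + h / ε * M := by
  refine (norm_le_norm_add_smul_perp (h / ε ^ 2) _).trans ?_
  rw [velocityUpdate_add_smul_perp]
  refine (norm_add_le _ _).trans ?_
  rw [norm_smul, Real.norm_of_nonneg (by positivity)]
  gcongr
  exact hb.size t ht _

theorem norm_velocityUpdate_sub_velocityUpdate_le (hb : FieldBounds E K L M) (hε : 0 < ε)
    (hh : 0 ≤ h) (ht : 0 ≤ t) (p q : Phase) :
    ‖velocityUpdate ε h E t p - velocityUpdate ε h E t q‖ ≤ (1 + h / ε * K) * ‖p - q‖ := by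
  have hK := hb.K_nonneg
  have h1 : ‖p.1 - q.1‖ ≤ ‖p - q‖ := norm_fst_le (p - q)
  have h2 : ‖p.2 - q.2‖ ≤ ‖p - q‖ := norm_snd_le (p - q)
  refine (norm_le_norm_add_smul_perp (h / ε ^ 2) _).trans ?_
  have hp := velocityUpdate_add_smul_perp ε h E t p
  have hq := velocityUpdate_add_smul_perp ε h E t q
  calc _ = ‖(p.2 - q.2) + (h / ε) • (E t p.1 - E t q.1)‖ := by
        rw [perp_sub]; congr 1
        linear_combination (norm := module) hp - hq
    _ ≤ ‖p - q‖ + h / ε * (K * ‖p - q‖) := by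
      refine (norm_add_le _ _).trans ?_
      rw [norm_smul, Real.norm_of_nonneg (by positivity)]
      gcongr
      exact (hb.space t ht _ _).trans (by gcongr)
    _ = _ := by ring

theorem norm_velocityUpdate_sub_le (hb : FieldBounds E K L M) (hε : 0 < ε)
    (hh : 0 ≤ h) (hh1 : h ≤ 1) (ht : 0 ≤ t) (p : Phase) :
    ‖velocityUpdate ε h E t p - p.2‖ ≤
      (M / ε + (1 + M / ε) / ε ^ 2) * h * (1 + ‖p‖) := by
  have hM := hb.M_nonneg
  have h2 : ‖p.2‖ ≤ ‖p‖ := norm_snd_le p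
  have h0 : 0 ≤ ‖p‖ := norm_nonneg p
  have hw := norm_velocityUpdate_le hb hε hh ht p
  have hp := velocityUpdate_add_smul_perp ε h E t p
  have hw' : ‖velocityUpdate ε h E t p‖ ≤ (1 + M / ε) * (1 + ‖p‖) := by
    have : h / ε * M ≤ M / ε := by
      calc h / ε * M ≤ 1 / ε * M := by gcongr
        _ = M / ε := by ring
    have h3 : 0 ≤ M / ε * ‖p‖ := by positivity
    linarith
  calc ‖velocityUpdate ε h E t p - p.2‖
      = ‖(h / ε) • E t p.1 - (h / ε ^ 2) • perp (velocityUpdate ε h E t p)‖ := by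
        congr 1
        linear_combination (norm := module) hp
    _ ≤ h / ε * (M * (1 + ‖p‖)) + h / ε ^ 2 * ((1 + M / ε) * (1 + ‖p‖)) := by
      refine (norm_sub_le _ _).trans ?_
      rw [norm_smul, norm_smul, norm_perp, Real.norm_of_nonneg (by positivity),
        Real.norm_of_nonneg (by positivity)]
      gcongr
      exact (hb.size t ht _).trans (le_mul_of_one_le_right hM (by linarith))
    _ = _ := by ring

/-- The constant degenerates as `ε → 0`. This is harmless: it is used only for qualitative
convergence at fixed `ε`, and does not enter the final rate. -/
theorem isConsistentStep_schemeStep (hb : FieldBounds E K L M) (hε : 0 < ε) :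
    ∃ c, 0 ≤ c ∧ ∀ t h, 0 ≤ t → 0 ≤ h → h ≤ 1 →
      IsConsistentStep (phaseField ε E) c t h (schemeStep ε h E t) := by
  have hK := hb.K_nonneg; have hM := hb.M_nonneg
  set c₀ := M / ε + (1 + M / ε) / ε ^ 2 with hc₀
  have hc₀0 : 0 ≤ c₀ := by positivity
  set c₁ := ε⁻¹ * (1 + ε⁻¹ * K) + ε⁻¹ * K with hc₁
  set c₂ := ε⁻¹ * (1 + c₀) + c₀ with hc₂
  set c₃ := ε⁻¹ * c₀ + ε⁻¹ ^ 2 * c₀ with hc₃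
  have hc₁0 : 0 ≤ c₁ := by positivity
  have hc₂0 : 0 ≤ c₂ := by positivity
  have hc₃0 : 0 ≤ c₃ := by positivity
  refine ⟨c₁ + c₂ + c₃, by positivity, fun t h ht hh hh1 => ⟨fun p q => ?_, fun p => ?_,
    fun p => ?_⟩⟩
  · have h1 : ‖p.1 - q.1‖ ≤ ‖p - q‖ := norm_fst_le (p - q)
    have hd := norm_velocityUpdate_sub_velocityUpdate_le hb hε hh ht p q
    have hle : (1 + c₁ * h) * ‖p - q‖ ≤ (1 + (c₁ + c₂ + c₃) * h) * ‖p - q‖ := by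
      gcongr
      linarith
    refine le_trans (max_le ?_ ?_) hle
    · simp only [schemeStep, Prod.fst_sub]
      calc _ = ‖(p.1 - q.1) + (h / ε) • (velocityUpdate ε h E t p - velocityUpdate ε h E t q)‖ := by
            congr 1; module
        _ ≤ ‖p - q‖ + h / ε * ((1 + 1 / ε * K) * ‖p - q‖) := by
          refine (norm_add_le _ _).trans ?_
          rw [norm_smul, Real.norm_of_nonneg (by positivity)]
          gcongr
          exact hd.trans (by gcongr)
        _ = (1 + ε⁻¹ * (1 + ε⁻¹ * K) * h) * ‖p - q‖ := by ring
        _ ≤ _ := by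
          gcongr
          rw [hc₁]
          exact le_add_of_nonneg_right (by positivity)
    · simp only [schemeStep, Prod.snd_sub]
      refine hd.trans ?_
      rw [show h / ε * K = ε⁻¹ * K * h by ring]
      gcongr
      rw [hc₁]
      exact le_add_of_nonneg_left (by positivity)
  · have h2 : ‖p.2‖ ≤ ‖p‖ := norm_snd_le p
    have hd := norm_velocityUpdate_sub_le hb hε hh hh1 ht p
    have hle : c₂ * h * (1 + ‖p‖) ≤ (c₁ + c₂ + c₃) * h * (1 + ‖p‖) := by
      gcongr
      linarith
    refine le_trans (max_le ?_ ?_) hle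
    · simp only [schemeStep, Prod.fst_sub, add_sub_cancel_left]
      rw [norm_smul, Real.norm_of_nonneg (by positivity)]
      calc _ = h / ε * ‖p.2 + (velocityUpdate ε h E t p - p.2)‖ := by
            congr 2; module
        _ ≤ h / ε * ((1 + ‖p‖) + c₀ * 1 * (1 + ‖p‖)) := by
          gcongr
          refine (norm_add_le _ _).trans ?_
          gcongr
          · linarith
          · exact hd.trans (by gcongr)
        _ = ε⁻¹ * (1 + c₀) * h * (1 + ‖p‖) := by ring
        _ ≤ _ := by
          gcongr
          exact le_add_of_nonneg_right hc₀0
    · simp only [schemeStep, Prod.snd_sub]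
      refine hd.trans ?_
      gcongr
      exact le_add_of_nonneg_left (by positivity)
  · have hd := norm_velocityUpdate_sub_le hb hε hh hh1 ht p
    have hp := velocityUpdate_add_smul_perp ε h E t p
    have hle : c₃ * h ^ 2 * (1 + ‖p‖) ≤ (c₁ + c₂ + c₃) * h ^ 2 * (1 + ‖p‖) := by
      gcongr
      linarith
    refine le_trans (max_le ?_ ?_) hle
    · simp only [schemeStep, phaseField, Prod.fst_sub, add_sub_cancel_left, Prod.smul_fst]
      calc _ = ‖(h / ε) • (velocityUpdate ε h E t p - p.2)‖ := by
            congr 1; rw [div_eq_mul_inv]; module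
        _ ≤ h / ε * (c₀ * h * (1 + ‖p‖)) := by
          rw [norm_smul, Real.norm_of_nonneg (by positivity)]
          gcongr
        _ = ε⁻¹ * c₀ * h ^ 2 * (1 + ‖p‖) := by ring
        _ ≤ _ := by
          gcongr
          exact le_add_of_nonneg_right (by positivity)
    · simp only [schemeStep, phaseField, Prod.snd_sub, Prod.smul_snd]
      calc _ = ‖-((h / ε ^ 2) • perp (velocityUpdate ε h E t p - p.2))‖ := by
            rw [perp_sub]; congr 1
            rw [div_eq_mul_inv] at hp ⊢
            rw [← inv_pow, div_eq_mul_inv] at *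
            linear_combination (norm := module) hp
        _ ≤ h / ε ^ 2 * (c₀ * h * (1 + ‖p‖)) := by
          rw [norm_neg, norm_smul, norm_perp, Real.norm_of_nonneg (by positivity)]
          gcongr
        _ = ε⁻¹ ^ 2 * c₀ * h ^ 2 * (1 + ‖p‖) := by ring
        _ ≤ _ := by
          gcongr
          exact le_add_of_nonneg_left (by positivity)

theorem continuous_perp : Continuous perp :=
  (LipschitzWith.of_dist_le_mul (K := 1) fun x y => by
    rw [dist_eq_norm, dist_eq_norm, ← perp_sub, norm_perp]; simp).continuous

theorem FieldBounds.continuous (hb : FieldBounds E K L M) (ht : 0 ≤ t) : Continuous (E t) :=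
  (LipschitzWith.of_dist_le' (K := K) fun x y => by
    rw [dist_eq_norm, dist_eq_norm]; exact hb.space t ht x y).continuous

theorem continuous_schemeStep (hb : FieldBounds E K L M) (ht : 0 ≤ t) :
    Continuous (schemeStep ε h E t) := by
  have h1 := hb.continuous ht
  have h2 := continuous_perp
  unfold schemeStep velocityUpdate
  fun_prop

theorem continuous_discreteFlow (hb : FieldBounds E K L M) (hh : 0 ≤ h) (n : ℕ) :
    Continuous (discreteFlow ε h E n) := by
  induction n with
  | zero => exact continuous_id
  | succ n ih => exact (continuous_schemeStep hb (by positivity)).comp ih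

end Step

/-! ### Passage to the limit in the refinement and conclusion. -/

/-- Error of the scheme tested against a bounded `1`-Lipschitz function of the position, given a
pathwise error bound between the scheme and all its refinements. -/
theorem abs_integral_discreteFlow_sub_le {E : ℝ → Plane → Plane} {K L M ε Δt G : ℝ}
    (hb : FieldBounds E K L M) (hε : 0 < ε) (hΔt : 0 < Δt) {f₀ : ProbabilityMeasure Phase}
    {f : ℝ → ProbabilityMeasure Phase} (hf : IsVlasovSolution ε E f₀ f) {n : ℕ}
    (hint : Integrable (fun p : Phase => 1 + ε + ‖p.2‖) (f₀ : Measure Phase))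
    (hG : ∀ (m : ℕ) (p : Phase), 0 < m → ‖(discreteFlow ε Δt E n p).1 -
      (discreteFlow ε (Δt / m) E (n * m) p).1‖ ≤ G * (1 + ε + ‖p.2‖))
    {φ : Plane → ℝ} {B : ℝ} (hφ : ∀ x y, |φ x - φ y| ≤ ‖x - y‖) (hB : ∀ x, |φ x| ≤ B) :
    |(∫ p, φ (discreteFlow ε Δt E n p).1 ∂(f₀ : Measure Phase)) -
      ∫ p, φ p.1 ∂(f (n * Δt) : Measure Phase)| ≤
      G * ∫ p, (1 + ε + ‖p.2‖) ∂(f₀ : Measure Phase) := by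
  refine le_of_forall_pos_le_add fun κ hκ => ?_
  obtain ⟨c, hc, hstep⟩ := isConsistentStep_schemeStep hb hε
  obtain ⟨h₀, hh₀, H⟩ := exists_step_size_of_bounded (φ := fun p : Phase => φ p.1) (a := 1) (B := B)
    (c := c) (T := n * Δt) (κ := κ)
    (fun p q => by rw [one_mul]; exact (hφ _ _).trans (norm_fst_le (p - q))) (fun p => hB _)
    zero_le_one hc (by positivity) hκ (velocityBounds_phaseField hb hε) (hf.isWeakTransport hε)
  -- The refined step must be below `1`, for consistency, and below `h₀`, for accuracy `κ`; the
  -- coarse bound does not depend on this `m`.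
  obtain ⟨m, hm⟩ := exists_nat_gt (Δt / min 1 h₀)
  have hmin : 0 < min 1 h₀ := lt_min one_pos hh₀
  have hm0' : (0 : ℝ) < m := lt_trans (by positivity) hm
  have hm0 : 0 < m := by exact_mod_cast hm0'
  have hh : Δt / m ≤ min 1 h₀ := by
    rw [div_lt_iff₀ hmin] at hm
    rw [div_le_iff₀ hm0']
    linarith
  have hfine := H (Δt / m) (n * m) (fun k => schemeStep ε (Δt / m) E (k * (Δt / m)))
    (discreteFlow ε (Δt / m) E) (by positivity) (hh.trans (min_le_right _ _))
    (by push_cast; field_simp)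
    (fun k => hstep _ _ (by positivity) (by positivity) (hh.trans (min_le_left _ _)))
    (fun p => rfl) (fun k p => rfl)
  rw [hf.1] at hfine
  have hφc : Continuous φ := (LipschitzWith.of_dist_le' (K := 1) fun x y => by
    rw [Real.dist_eq, dist_eq_norm, one_mul]; exact hφ x y).continuous
  have hi : ∀ h k, 0 ≤ h → Integrable (fun p => φ (discreteFlow ε h E k p).1)
      (f₀ : Measure Phase) := fun h k hh =>
    Integrable.of_bound (hφc.comp (continuous_fst.comp
      (continuous_discreteFlow hb hh k))).measurable.aestronglyMeasurable B
      (Filter.Eventually.of_forall fun p => hB _)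
  have hcoarse : |(∫ p, φ (discreteFlow ε Δt E n p).1 ∂(f₀ : Measure Phase)) -
      ∫ p, φ (discreteFlow ε (Δt / m) E (n * m) p).1 ∂(f₀ : Measure Phase)| ≤
      G * ∫ p, (1 + ε + ‖p.2‖) ∂(f₀ : Measure Phase) := by
    rw [← integral_sub (hi _ _ hΔt.le) (hi _ _ (by positivity)), ← integral_const_mul,
      ← Real.norm_eq_abs]
    exact norm_integral_le_of_norm_le (hint.const_mul G)
      (Filter.Eventually.of_forall fun p => (hφ _ _).trans (hG m p hm0))
  refine (abs_sub_le _ _ _).trans (add_le_add hcoarse ?_)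
  rw [abs_sub_comm]
  exact hfine

end GyroVlasov

theorem corollary3p3 (E : ℝ → GyroVlasov.Plane → GyroVlasov.Plane)
    (hE : GyroVlasov.IsLipschitzField E) :
    ∃ C : ℝ, 0 < C ∧
      ∀ (f₀ : ProbabilityMeasure GyroVlasov.Phase),
        Integrable (fun p : GyroVlasov.Phase => ‖p‖) (f₀ : Measure GyroVlasov.Phase) →
      ∀ (ε Δt : ℝ), 0 < ε → 0 < Δt →
      ∀ (f : ℝ → ProbabilityMeasure GyroVlasov.Phase), GyroVlasov.IsVlasovSolution ε E f₀ f →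
      ∀ n : ℕ,
        GyroVlasov.wNegDist
            (GyroVlasov.discreteDensity ε Δt E (f₀ : Measure GyroVlasov.Phase) n)
            (GyroVlasov.chargeDensity (f (n * Δt) : Measure GyroVlasov.Phase)) ≤
          ENNReal.ofReal
            (C * min (Δt / ε ^ 3 * (1 + ε ^ 2)) (Δt + ε) *
              Real.exp (2 * GyroVlasov.lipX E * (n * Δt)) * (1 + (n * Δt) ^ 2) *
              ∫ p, (1 + ε + ‖p.2‖) ∂(f₀ : Measure GyroVlasov.Phase)) := by
  obtain ⟨L, M, hb⟩ := hE.exists_fieldBounds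
  obtain ⟨C, hC, hbound⟩ := GyroVlasov.exists_refinement_bound hb
  refine ⟨C, hC, fun f₀ hmom ε Δt hε hΔt f hf n => ?_⟩
  have hint : Integrable (fun p : GyroVlasov.Phase => 1 + ε + ‖p.2‖)
      (f₀ : Measure GyroVlasov.Phase) :=
    (integrable_const _).add (hmom.mono' (by fun_prop)
      (Filter.Eventually.of_forall fun p => by rw [norm_norm]; exact norm_snd_le p))
  refine iSup_le fun φ => ENNReal.ofReal_le_ofReal ?_
  obtain ⟨B, hB⟩ := φ.2.1
  have hφ := φ.2.abs_sub_le
  have hφc : Continuous φ.1 := φ.2.2.1.choose_spec.continuous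
  have hflow : Continuous fun p => (GyroVlasov.discreteFlow ε Δt E n p).1 :=
    continuous_fst.comp (GyroVlasov.continuous_discreteFlow hb hΔt.le n)
  rw [GyroVlasov.discreteDensity, GyroVlasov.chargeDensity,
    integral_map hflow.measurable.aemeasurable hφc.measurable.aestronglyMeasurable,
    integral_map measurable_fst.aemeasurable hφc.measurable.aestronglyMeasurable]
  refine GyroVlasov.abs_integral_discreteFlow_sub_le hb hε hΔt hf hint (fun m p hm => ?_) hφ hB
  have hm' : (m : ℝ) ≠ 0 := by exact_mod_cast hm.ne'
  -- The coarse scheme is viewed as an orbit of step `m * (Δt / m)`, the form required by the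
  -- refinement bound.
  have hstep : (m : ℝ) * (Δt / m) = Δt := by field_simp
  have := hbound ε (Δt / m) m n _ _ _ _ hε (by positivity)
    (hstep.symm ▸ GyroVlasov.isOrbit_discreteFlow ε Δt E p)
    (GyroVlasov.isOrbit_discreteFlow ε (Δt / m) E p) rfl rfl
  rwa [hstep] at this
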